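/- Let $(X,d)$ be a complete metric space that is doubling: for some $N\in\mathbb N$, every closed ball $B(x,r)=\{y: d(x,y)\le r\}$, $r>0$, is covered by $N$ closed balls of radius $r/2$. Let $m\in\mathbb N$ and let $\{E_{\mathtt i}\}$ be compact subsets of $X$ indexed by the finite words $\mathtt i$ (including the empty word) over $\{1,\dots,m\}$. Suppose that there are constants $0<C_0,C_1<\infty$ such that, for all finite words $\mathtt i$, all letters $i,j$ and all infinite words $\mathtt j$, with $\mathtt j|_n$ the initial subword of $\mathtt j$ of length $n$: (M1) $E_{\mathtt i i}\subset E_{\mathtt i}$; (M2) $E_{\mathtt i i}\cap E_{\mathtt i j}=\varnothing$ if $i\ne j$; (M3) there is $x\in E_{\mathtt i}$ with $B(x,C_0\operatorname{diam}E_{\mathtt i})\subset E_{\mathtt i}$; (M4) $\operatorname{diam}(E_{\mathtt j|_n})\to0$ as $n\to\infty$; (M5) $\operatorname{diam}(E_{\mathtt i})\le C_1\operatorname{diam}(E_{\mathtt i i})$. Let $E=\bigcap_n\bigcup_{|\mathtt i|=n}E_{\mathtt i}$ be the limit set and, for an infinite word $\mathtt i$, let $x_{\mathtt i}$ be the point with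 $\{x_{\mathtt i}\}=\bigcap_nE_{\mathtt i|_n}$. Let $r_1,\dots,r_m\colon E\to(0,1)$ be continuous, put $r_{\mathtt i}(x)=\prod_{k=1}^n r_{i_k}(x)$ for a word $\mathtt i=i_1\cdots i_n$, and suppose that (M6) $\log\operatorname{diam}(E_{\mathtt i|_n})/\log r_{\mathtt i|_n}(x_{\mathtt i})\to1$ as $n\to\infty$, uniformly over all infinite words $\mathtt i$. Let $\mu$ be a Borel probability measure on $X$ with support $\operatorname{spt}\mu=E$, and define weights by $\mu(E_{\mathtt i i})=p_{\mathtt i}^{i}\,\mu(E_{\mathtt i})$. Let $p_1,\dots,p_m\colon E\to(0,1)$ be continuous with $\sum_{i=1}^m p_i(x)=1$ for all $x\in E$, and suppose that $p^{i}_{\mathtt i|_n}\to p_i(x_{\mathtt i})$ as $n\to\infty$ for every $i$, uniformly over all infinite words $\mathtt i$. For $q\in\mathbb R$ and bounded $A\subset X$ put $$\tau_q(\mu,A)=\liminf_{\delta\downarrow0}\frac{\log S_q(\mu,A,\delta)}{\log\delta},\qquad S_q(\mu,A,\delta)=\sup\sum_{B\in\mathcal B}\mu(B)^q,$$ where the supremum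 is over all countable collections $\mathcal B$ of pairwise disjoint closed balls of radius $\delta$ with centres in $A\cap\operatorname{spt}\mu$, and $\tau_q(\mu,x)=\lim_{r\downarrow0}\tau_q(\mu,B(x,r))$. For $\mu(A)>0$ let $\overline{\dim}_1(\mu,A)$ and $\underline{\dim}_1(\mu,A)$ be the $\limsup$ and the $\liminf$, as $\delta\downarrow0$, of $$\frac1{\mu(A)}\int_A\frac{\log\mu(B(y,\delta))}{\log\delta}\,d\mu(y),$$ and put $\overline{\dim}_1(\mu,x)=\limsup_{r\downarrow0}\overline{\dim}_1(\mu,B(x,r))$ and $\underline{\dim}_1(\mu,x)=\liminf_{r\downarrow0}\underline{\dim}_1(\mu,B(x,r))$. Let $\overline{\dim}_{\mathrm{loc}}(\mu,x)$ and $\underline{\dim}_{\mathrm{loc}}(\mu,x)$ be the $\limsup$ and the $\liminf$ of $\log\mu(B(x,r))/\log r$ as $r\downarrow0$. Write $\dim_1(\mu,x)$ and $\dim_{\mathrm{loc}}(\mu,x)$ for the common values when the upper and lower quantities agree. Theorem. For all $x\in E$ and all $q\ge0$, the limit $\tau_q(\mu,x)$ exists and is the unique $\tau\in\mathbb R$ that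 satisfies $$\sum_{i=1}^m p_i(x)^q\,r_i(x)^{-\tau}=1.$$ Moreover, for $\mu$-almost every $x\in E$, the dimensions $\dim_1(\mu,x)$ and $\dim_{\mathrm{loc}}(\mu,x)$ exist and $$\dim_1(\mu,x)=\dim_{\mathrm{loc}}(\mu,x)=\frac{\sum_{i=1}^m p_i(x)\log p_i(x)}{\sum_{i=1}^m p_i(x)\log r_i(x)}.$$ -/

import Mathlib

open MeasureTheory Filter Set Metric
open scoped Topology ENNReal

noncomputable section

namespace MoranLq

/-- A metric space is doubling if, for some constant `N`, every closed ball of radius `r > 0` can be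
covered by `N` closed balls of radius `r / 2`. -/
def IsDoublingSpace (X : Type*) [MetricSpace X] : Prop :=
  ∃ N : ℕ, ∀ (x : X) (r : ℝ), 0 < r →
    ∃ s : Finset X, s.card ≤ N ∧ closedBall x r ⊆ ⋃ y ∈ s, closedBall y (r / 2)

section Dimensions

variable {X : Type*} [MetricSpace X] [MeasurableSpace X]

/-- The upper local dimension `limsup_{r ↓ 0} log μ(B(x,r)) / log r`, with values in `[-∞, ∞]`. -/
def upperLocalDim (μ : Measure X) (x : X) : EReal :=
  limsup (fun r : ℝ => ENNReal.log (μ (closedBall x r)) / (Real.log r : EReal)) (𝓝[>] 0)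

/-- The lower local dimension `liminf_{r ↓ 0} log μ(B(x,r)) / log r`, with values in `[-∞, ∞]`. -/
def lowerLocalDim (μ : Measure X) (x : X) : EReal :=
  liminf (fun r : ℝ => ENNReal.log (μ (closedBall x r)) / (Real.log r : EReal)) (𝓝[>] 0)

/-- `C` is the set of centres of a `δ`-packing of `A`: a countable collection of pairwise disjoint
closed balls of radius `δ` centred in `A`. -/
def IsPackingCenters (A : Set X) (δ : ℝ) (C : Set X) : Prop :=
  C ⊆ A ∧ C.Countable ∧ C.PairwiseDisjoint (fun y => closedBall y δ)

/-- The `L^q`-moment sum `S_q(μ, A, δ)`: the supremum of `∑ μ(B)^q` over all `δ`-packings of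
`A ∩ spt μ`. -/
def momentSum (μ : Measure X) (q : ℝ) (A : Set X) (δ : ℝ) : ℝ≥0∞ :=
  ⨆ (C : Set X) (_ : IsPackingCenters (A ∩ μ.support) δ C),
    ∑' y : C, μ (closedBall (y : X) δ) ^ q

/-- The `L^q`-spectrum `τ_q(μ, A) = liminf_{δ ↓ 0} log S_q(μ, A, δ) / log δ` of `μ` on `A`. -/
def lqSpectrum (μ : Measure X) (q : ℝ) (A : Set X) : EReal :=
  liminf (fun δ : ℝ => ENNReal.log (momentSum μ q A δ) / (Real.log δ : EReal)) (𝓝[>] 0)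

/-- `t` is the local `L^q`-spectrum `τ_q(μ, x) = lim_{r ↓ 0} τ_q(μ, B(x,r))`; the existence of the
limit is part of the assertion. -/
def HasLocalLqSpectrum (μ : Measure X) (q : ℝ) (x : X) (t : EReal) : Prop :=
  Tendsto (fun r : ℝ => lqSpectrum μ q (closedBall x r)) (𝓝[>] 0) (𝓝 t)

/-- The mean value `μ(A)⁻¹ ∫_A f dμ` of an extended real valued function, the integral being the
integral of the positive part minus the integral of the negative part. -/
def meanValue (μ : Measure X) (A : Set X) (f : X → EReal) : EReal :=
  (((∫⁻ y in A, (f y).toENNReal ∂μ : ℝ≥0∞) : EReal)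
    - ((∫⁻ y in A, (-f y).toENNReal ∂μ : ℝ≥0∞) : EReal)) / ((μ A : ℝ≥0∞) : EReal)

/-- The mean over `y ∈ A` of `log μ(B(y,δ)) / log δ`. -/
def meanEntropy (μ : Measure X) (A : Set X) (δ : ℝ) : EReal :=
  meanValue μ A (fun y => ENNReal.log (μ (closedBall y δ)) / (Real.log δ : EReal))

/-- The upper entropy dimension of `μ` on `A`. -/
def upperEntropyDim (μ : Measure X) (A : Set X) : EReal :=
  limsup (fun δ : ℝ => meanEntropy μ A δ) (𝓝[>] 0)

/-- The lower entropy dimension of `μ` on `A`. -/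
def lowerEntropyDim (μ : Measure X) (A : Set X) : EReal :=
  liminf (fun δ : ℝ => meanEntropy μ A δ) (𝓝[>] 0)

/-- The local upper entropy dimension of `μ` at `x`. -/
def localUpperEntropyDim (μ : Measure X) (x : X) : EReal :=
  limsup (fun r : ℝ => upperEntropyDim μ (closedBall x r)) (𝓝[>] 0)

/-- The local lower entropy dimension of `μ` at `x`. -/
def localLowerEntropyDim (μ : Measure X) (x : X) : EReal :=
  liminf (fun r : ℝ => lowerEntropyDim μ (closedBall x r)) (𝓝[>] 0)

end Dimensions

section Moran

variable {X : Type*} [MetricSpace X] {m : ℕ}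

/-- The word `s|_n` formed by the first `n` letters of the infinite word `s`. -/
def initialWord (s : ℕ → Fin m) (n : ℕ) : List (Fin m) :=
  List.ofFn (fun k : Fin n => s k)

/-- The limit set `⋂_n ⋃_{|w| = n} E_w`. -/
def limitSet (E : List (Fin m) → Set X) : Set X :=
  ⋂ n : ℕ, ⋃ (w : List (Fin m)) (_ : w.length = n), E w

/-- The pairs `(s, x)` of an infinite word `s` and the point `x = x_s` coded by it, i.e. the point
of `⋂_n E_{s|_n}`. For a Moran construction every `s` codes exactly one point. -/
def codingPairs (E : List (Fin m) → Set X) : Set ((ℕ → Fin m) × X) :=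
  {z | ∀ n : ℕ, z.2 ∈ E (initialWord z.1 n)}

/-- A Moran construction: compact sets `E_w` indexed by the finite words `w` over an alphabet with
`m` letters, with the following properties. Here `w ++ [i]` is the word `w` followed by `i`. -/
structure IsMoranConstruction (E : List (Fin m) → Set X) : Prop where
  compact : ∀ w, IsCompact (E w)
  nested : ∀ w i, E (w ++ [i]) ⊆ E w
  disjoint : ∀ w i j, i ≠ j → Disjoint (E (w ++ [i])) (E (w ++ [j]))
  inner_ball : ∃ C₀ : ℝ, 0 < C₀ ∧ ∀ w, ∃ x ∈ E w, closedBall x (C₀ * diam (E w)) ⊆ E w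
  diam_tendsto : ∀ s : ℕ → Fin m, Tendsto (fun n => diam (E (initialWord s n))) atTop (𝓝 0)
  diam_ratio : ∃ C₁ : ℝ, 0 < C₁ ∧ ∀ w i, diam (E w) ≤ C₁ * diam (E (w ++ [i]))

/-- `r_w(x) = ∏_k r_{w_k}(x)` for a finite word `w`. -/
def wordProd (r : Fin m → X → ℝ) (w : List (Fin m)) (x : X) : ℝ :=
  (w.map fun i => r i x).prod

/-- The sizes of the construction sets are asymptotically given by the functions `r_i`:
`log diam(E_{s|_n}) / log r_{s|_n}(x_s) → 1` as `n → ∞`, uniformly in the infinite word `s`. -/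
def HasContractionFunctions (E : List (Fin m) → Set X) (r : Fin m → X → ℝ) : Prop :=
  TendstoUniformlyOn
    (fun (n : ℕ) (z : (ℕ → Fin m) × X) =>
      Real.log (diam (E (initialWord z.1 n))) / Real.log (wordProd r (initialWord z.1 n) z.2))
    (fun _ => 1) atTop (codingPairs E)

/-- The weight `p_w^i` with `μ(E_{wi}) = p_w^i μ(E_w)`. -/
def weight [MeasurableSpace X] (μ : Measure X) (E : List (Fin m) → Set X)
    (w : List (Fin m)) (i : Fin m) : ℝ :=
  μ.real (E (w ++ [i])) / μ.real (E w)

/-- The weights converge to the functions `p_i`: `p_{s|_n}^i → p_i(x_s)` as `n → ∞`, for every `i`,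
uniformly in the infinite word `s`. -/
def HasLimitWeights [MeasurableSpace X] (μ : Measure X) (E : List (Fin m) → Set X)
    (p : Fin m → X → ℝ) : Prop :=
  ∀ i, TendstoUniformlyOn
    (fun (n : ℕ) (z : (ℕ → Fin m) × X) => weight μ E (initialWord z.1 n) i)
    (fun z => p i z.2) atTop (codingPairs E)

end Moran

end MoranLq

end

/-!
The proof compares all three dimensions with moment sums over *cut sets* of the tree of words. A cut
set at scale `δ` below a word `w` (`cut`, `IsCutSet`) consists of the extensions of `w` at which the
diameter of the cell first drops to `δ`. Its cells are disjoint, and by the inner balls and the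
doubling property only boundedly many of them meet a ball of radius comparable to `δ`
(`IsMoranConstruction.exists_isOverlapBound`).

Fix a point `x` of the limit set with code `s` and let `w = s|_n` with `n` large. Since the weights
and the contraction functions converge uniformly and the limits are continuous, the measure and the
diameter of the cell `E (w ++ v)` are, up to factors `exp (±(ε * |v| + K))`, the products along `v`
of the constants `p i x` and `r i x` (`IsMoranSystem.eventually_isControlled`). If `τ` solves
`∑ i, p i x ^ q * r i x ^ (-τ) = 1`, then `v ↦ ∏ p_{v_k}(x) ^ q * r_{v_k}(x) ^ (-τ)` is additive on
the tree and so sums to `1` over every cut set below `w`. Hence `∑ μ(E_u) ^ q`, taken over the cut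
set of scale `δ`, lies between constant multiples of `δ ^ (τ + η)` and `δ ^ (τ - η)`
(`IsMoranSystem.eventually_exists_cutSet_moment`). This holds for every real `q`.

* For `q ≥ 0` bounded overlap makes these sums comparable to the moment sums over packings
  (`exists_momentSum_le`, `sum_le_momentSum`), which gives the local `L^q`-spectrum.
* The function `q ↦ τ` vanishes at `q = 1` and has there the slope
  `D = (∑ p_i log p_i) / (∑ p_i log r_i)` (`exists_pressure_line_lt`). By Chebyshev's inequality
  with `q` slightly above or below `1`, the points near `x` with `μ(B(y,δ)) > δ ^ (D - ε)` or
  `μ(B(y,δ)) < δ ^ (D + ε)` have measure at most a positive power of `δ`. The Borel–Cantelli lemma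
  along `δ = 2 ^ (-k)` gives the local dimension at almost every point; no law of large numbers on
  the tree is needed (`IsMoranSystem.ae_tendsto_localDim`).
* The moments of order `q = -1` bound `log μ(B(y,δ)) / log δ` near `x`, so dominated convergence
  applies to its means over small balls. The continuity of `D` then gives the local entropy
  dimension, at every point of the limit set (`IsMoranSystem.localEntropyDim_eq`).
-/

namespace MoranLq

/-! ### Doubling spaces -/

section Doubling

variable {X : Type*} [MetricSpace X]

lemma IsDoublingSpace.exists_cover_pow (hX : IsDoublingSpace X) :
    ∃ N : ℕ, ∀ (k : ℕ) (x : X) (R : ℝ), 0 < R → ∃ s : Finset X, s.card ≤ N ^ k ∧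
      closedBall x R ⊆ ⋃ y ∈ s, closedBall y (R / 2 ^ k) := by
  classical
  obtain ⟨N, hN⟩ := hX
  refine ⟨N, fun k => ?_⟩
  induction k with
  | zero => exact fun x R _ => ⟨{x}, by simp, by simp⟩
  | succ k ih =>
    intro x R hR
    obtain ⟨s, hs, hsub⟩ := ih x R hR
    choose t ht htsub using fun y : X => hN y (R / 2 ^ k) (by positivity)
    refine ⟨s.biUnion t, ?_, ?_⟩
    · calc (s.biUnion t).card ≤ s.card * N := Finset.card_biUnion_le_card_mul _ _ _ fun y _ => ht y
        _ ≤ N ^ k * N := by gcongr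
        _ = N ^ (k + 1) := (pow_succ _ _).symm
    · intro z hz
      obtain ⟨y, hy, hzy⟩ := mem_iUnion₂.1 (hsub hz)
      obtain ⟨u, hu, hzu⟩ := mem_iUnion₂.1 (htsub y hzy)
      refine mem_iUnion₂.2 ⟨u, Finset.mem_biUnion.2 ⟨y, hy, hu⟩, ?_⟩
      rwa [pow_succ, ← div_div]

/-- In a doubling space, a ball of radius `a * δ` contains a bounded number of points whose mutual
distances exceed `b * δ`, and the bound does not depend on the scale `δ`. -/
lemma IsDoublingSpace.exists_card_le (hX : IsDoublingSpace X) {a b : ℝ} (ha : 0 < a) (hb : 0 < b)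
    (ι : Type*) :
    ∃ M : ℕ, ∀ (δ : ℝ), 0 < δ → ∀ (z : X) (F : Finset ι) (f : ι → X),
      (∀ i ∈ F, f i ∈ closedBall z (a * δ)) →
      (∀ i ∈ F, ∀ j ∈ F, i ≠ j → b * δ < dist (f i) (f j)) → F.card ≤ M := by
  obtain ⟨N, hN⟩ := hX.exists_cover_pow
  obtain ⟨k, hk⟩ := pow_unbounded_of_one_lt (2 * a / b) (one_lt_two (α := ℝ))
  refine ⟨N ^ k, fun δ hδ z F f hF hsep => ?_⟩
  obtain ⟨s, hs, hsub⟩ := hN k z (a * δ) (by positivity)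
  have hex : ∀ i : ι, ∃ y : X, i ∈ F → y ∈ s ∧ f i ∈ closedBall y (a * δ / 2 ^ k) := fun i => by
    by_cases hi : i ∈ F
    · obtain ⟨y, hy, h⟩ := mem_iUnion₂.1 (hsub (hF i hi))
      exact ⟨y, fun _ => ⟨hy, h⟩⟩
    · exact ⟨z, fun h => absurd h hi⟩
  choose g hg using hex
  refine (Finset.card_le_card_of_injOn g (fun i hi => (hg i hi).1) ?_).trans hs
  intro i hi j hj hij
  by_contra hne
  have h1 := mem_closedBall.1 (hg i hi).2
  have h2 := mem_closedBall'.1 (hg j hj).2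
  rw [hij] at h1
  have h3 := dist_triangle (f i) (g j) (f j)
  have h4 := hsep i hi j hj hne
  have h5 : 2 * (a * δ / 2 ^ k) ≤ b * δ := by
    rw [div_lt_iff₀ hb] at hk
    have : 2 * (a * δ / 2 ^ k) = (2 * a) * δ / 2 ^ k := by ring
    rw [this, div_le_iff₀ (by positivity)]
    nlinarith
  linarith

lemma IsDoublingSpace.properSpace [CompleteSpace X] (hX : IsDoublingSpace X) : ProperSpace X := by
  obtain ⟨N, hN⟩ := hX.exists_cover_pow
  refine ProperSpace.of_isCompact_closedBall_of_le 1 fun x R hR => ?_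
  refine TotallyBounded.isCompact_of_isClosed (Metric.totallyBounded_iff.2 fun ε hε => ?_)
    isClosed_closedBall
  obtain ⟨k, hk⟩ := pow_unbounded_of_one_lt (R / ε) (one_lt_two (α := ℝ))
  obtain ⟨s, -, hsub⟩ := hN k x R (by linarith)
  refine ⟨s, s.finite_toSet, hsub.trans (iUnion₂_mono fun y _ => closedBall_subset_ball ?_)⟩
  rw [div_lt_iff₀ hε] at hk
  rw [div_lt_iff₀ (by positivity)]
  linarith

end Doubling

/-! ### Words and cells of a Moran construction -/

section Words

variable {m : ℕ}

@[simp] lemma initialWord_length (s : ℕ → Fin m) (n : ℕ) : (initialWord s n).length = n := by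
  simp [initialWord]

@[simp] lemma initialWord_zero (s : ℕ → Fin m) : initialWord s 0 = [] := by
  simp [initialWord]

lemma initialWord_succ (s : ℕ → Fin m) (n : ℕ) :
    initialWord s (n + 1) = initialWord s n ++ [s n] := by
  rw [initialWord, List.ofFn_succ_last]
  rfl

lemma mem_limitSet_of_coding {X : Type*} {E : List (Fin m) → Set X} {s : ℕ → Fin m} {x : X}
    (h : (s, x) ∈ codingPairs E) : x ∈ limitSet E :=
  mem_iInter.2 fun n => mem_iUnion₂.2 ⟨initialWord s n, by simp, h n⟩

end Words

section Cells

variable {X : Type*} [MetricSpace X] {m : ℕ} {E : List (Fin m) → Set X}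

namespace IsMoranConstruction

lemma append_subset (hE : IsMoranConstruction E) (w v : List (Fin m)) : E (w ++ v) ⊆ E w := by
  induction v using List.reverseRecOn with
  | nil => simp
  | append_singleton v i ih =>
    rw [← List.append_assoc]
    exact (hE.nested _ i).trans ih

lemma nonempty (hE : IsMoranConstruction E) (w : List (Fin m)) : (E w).Nonempty := by
  obtain ⟨C₀, -, h⟩ := hE.inner_ball
  obtain ⟨x, hx, -⟩ := h w
  exact ⟨x, hx⟩

lemma diam_append_le (hE : IsMoranConstruction E) (w v : List (Fin m)) :
    diam (E (w ++ v)) ≤ diam (E w) :=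
  diam_mono (hE.append_subset w v) (hE.compact w).isBounded

lemma diam_pos (hE : IsMoranConstruction E) (hm : 2 ≤ m) (w : List (Fin m)) :
    0 < diam (E w) := by
  obtain ⟨x, hx⟩ := hE.nonempty (w ++ [⟨0, by omega⟩])
  obtain ⟨y, hy⟩ := hE.nonempty (w ++ [⟨1, by omega⟩])
  have hne : x ≠ y := by
    rintro rfl
    exact disjoint_left.1 (hE.disjoint w ⟨0, by omega⟩ ⟨1, by omega⟩ (by simp)) hx hy
  exact (dist_pos.2 hne).trans_le
    (dist_le_diam_of_mem (hE.compact w).isBounded (hE.nested _ _ hx) (hE.nested _ _ hy))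

lemma eq_of_mem (hE : IsMoranConstruction E) {x : X} {w w' : List (Fin m)}
    (hlen : w.length = w'.length) (hw : x ∈ E w) (hw' : x ∈ E w') : w = w' := by
  induction w using List.reverseRecOn generalizing w' with
  | nil => simpa using (List.length_eq_zero_iff.1 (by simpa using hlen.symm)).symm
  | append_singleton v i ih =>
    rcases List.eq_nil_or_concat' w' with rfl | ⟨v', i', rfl⟩
    · simp at hlen
    · have hv : v = v' := ih (by simpa using hlen) (hE.nested _ _ hw) (hE.nested _ _ hw')
      subst hv
      by_cases hi : i = i'
      · rw [hi]
      · exact (disjoint_left.1 (hE.disjoint v i i' hi) hw hw').elim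

/-- Every point of the limit set is coded by an infinite word. -/
lemma exists_coding (hE : IsMoranConstruction E) {x : X} (hx : x ∈ limitSet E) :
    ∃ s : ℕ → Fin m, (s, x) ∈ codingPairs E := by
  have h : ∀ n, ∃ w : List (Fin m), w.length = n ∧ x ∈ E w := fun n => by
    obtain ⟨w, hw, hxw⟩ := mem_iUnion₂.1 (mem_iInter.1 hx n)
    exact ⟨w, hw, hxw⟩
  choose w hlen hw using h
  have hstep : ∀ n, ∃ i, w (n + 1) = w n ++ [i] := fun n => by
    rcases List.eq_nil_or_concat' (w (n + 1)) with h0 | ⟨v, i, hv⟩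
    · have := hlen (n + 1)
      simp [h0] at this
    · have hl := hlen (n + 1)
      have hx' := hw (n + 1)
      rw [hv] at hl hx'
      have hv' : v = w n := hE.eq_of_mem (by simpa [hlen n] using hl) (hE.nested _ _ hx') (hw n)
      exact ⟨i, by rw [hv, hv']⟩
  choose s hs using hstep
  refine ⟨s, fun n => ?_⟩
  have : initialWord s n = w n := by
    induction n with
    | zero => simp [List.length_eq_zero_iff.1 (hlen 0)]
    | succ n ih => rw [initialWord_succ, hs, ih]
  change x ∈ E (initialWord s n)
  rw [this]
  exact hw n

lemma initialWord_eq (hE : IsMoranConstruction E) {x : X} {s : ℕ → Fin m}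
    (h : (s, x) ∈ codingPairs E) {w : List (Fin m)} (hw : x ∈ E w) :
    initialWord s w.length = w :=
  hE.eq_of_mem (by simp) (h _) hw

lemma inter_limitSet_nonempty (hE : IsMoranConstruction E) (hm : 0 < m) (w : List (Fin m)) :
    (E w ∩ limitSet E).Nonempty := by
  -- any infinite word extending `w`
  let s : ℕ → Fin m := fun k => w.getD k ⟨0, hm⟩
  have hs : initialWord s w.length = w := by
    apply List.ext_getElem (by simp)
    intro k h1 h2
    simp [initialWord, s]
  have := IsCompact.nonempty_iInter_of_sequence_nonempty_isCompact_isClosed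
    (fun n => E (initialWord s n))
    (fun n => by rw [initialWord_succ]; exact hE.nested _ _) (fun n => hE.nonempty _)
    (hE.compact _) (fun n => (hE.compact _).isClosed)
  obtain ⟨x, hx⟩ := this
  rw [mem_iInter] at hx
  refine ⟨x, ?_, mem_limitSet_of_coding hx⟩
  have := hx w.length
  rwa [hs] at this

lemma exists_child (hE : IsMoranConstruction E) {x : X} {w : List (Fin m)} (hx : x ∈ limitSet E)
    (hw : x ∈ E w) : ∃ i, x ∈ E (w ++ [i]) := by
  obtain ⟨s, hs⟩ := hE.exists_coding hx
  refine ⟨s w.length, ?_⟩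
  have := hs (w.length + 1)
  rwa [initialWord_succ, hE.initialWord_eq hs hw] at this

/-- Cells of one generation are disjoint and compact, hence a positive distance apart: points of
the limit set near `E w` lie in `E w`. -/
lemma exists_closedBall_inter_limitSet_subset (hE : IsMoranConstruction E) (w : List (Fin m)) :
    ∃ d : ℝ, 0 < d ∧ ∀ y ∈ E w, closedBall y d ∩ limitSet E ⊆ E w := by
  have hfin : {v : List (Fin m) | v.length = w.length ∧ v ≠ w}.Finite :=
    (List.finite_length_eq (Fin m) w.length).subset fun v hv => hv.1
  let K : Set X := ⋃ v ∈ {v : List (Fin m) | v.length = w.length ∧ v ≠ w}, E v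
  have hK : IsCompact K := hfin.isCompact_biUnion fun v _ => hE.compact v
  have hdisj : Disjoint (E w) K := by
    refine disjoint_left.2 fun x hx hxK => ?_
    obtain ⟨v, ⟨hv, hne⟩, hxv⟩ := mem_iUnion₂.1 hxK
    exact hne (hE.eq_of_mem hv hxv hx)
  obtain ⟨r, hr, hdist⟩ := Metric.exists_pos_forall_lt_edist (hE.compact w) hK.isClosed hdisj
  refine ⟨r, by exact_mod_cast hr, fun y hy z hz => ?_⟩
  obtain ⟨v, hv, hzv⟩ := mem_iUnion₂.1 (mem_iInter.1 hz.2 w.length)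
  by_contra hzw
  have hvw : v ≠ w := by
    rintro rfl
    exact hzw hzv
  have h := hdist y hy z (mem_iUnion₂.2 ⟨v, ⟨hv, hvw⟩, hzv⟩)
  have h2 := mem_closedBall'.1 hz.1
  rw [edist_nndist] at h
  have h3 : (r : ℝ) < nndist y z := by exact_mod_cast h
  rw [coe_nndist] at h3
  linarith

/-- Disjoint cells of diameter comparable to `δ` contain disjoint balls of radius comparable to
`δ`, so in a doubling space only boundedly many of them meet a ball of radius `δ`. -/
lemma exists_card_meeting_le (hE : IsMoranConstruction E) (hX : IsDoublingSpace X) {C₁ : ℝ}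
    (hC₁ : 0 < C₁) :
    ∃ M : ℕ, ∀ δ : ℝ, 0 < δ → ∀ (z : X) (L : Finset (List (Fin m))),
      (∀ w ∈ L, diam (E w) ≤ δ ∧ δ ≤ C₁ * diam (E w)) →
      (∀ w ∈ L, ∀ w' ∈ L, w ≠ w' → Disjoint (E w) (E w')) →
      (∀ w ∈ L, (E w ∩ closedBall z (3 * δ)).Nonempty) → L.card ≤ M := by
  obtain ⟨C₀, hC₀, hball⟩ := hE.inner_ball
  choose c hc hcb using hball
  obtain ⟨M, hM⟩ := hX.exists_card_le (a := 4) (b := C₀ / (2 * C₁)) (by norm_num) (by positivity)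
    (List (Fin m))
  refine ⟨M, fun δ hδ z L hL hdisj hmeet =>
    hM δ hδ z L c (fun w hw => ?_) fun w hw w' hw' hne => ?_⟩
  · obtain ⟨y, hy, hyz⟩ := hmeet w hw
    have h1 := dist_le_diam_of_mem (hE.compact w).isBounded (hc w) hy
    have h2 := dist_triangle (c w) y z
    have h3 := (hL w hw).1
    rw [mem_closedBall] at hyz ⊢
    linarith
  · have h1 : c w' ∉ closedBall (c w) (C₀ * diam (E w)) := fun h =>
      disjoint_left.1 (hdisj w hw w' hw' hne) (hcb w h) (hc w')
    rw [mem_closedBall', not_le] at h1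
    have h2 := (hL w hw).2
    have h3 : C₀ / (2 * C₁) * δ ≤ C₀ * diam (E w) := by
      rw [div_mul_eq_mul_div, div_le_iff₀ (by positivity)]
      have : 0 ≤ diam (E w) := diam_nonneg
      nlinarith [mul_le_mul_of_nonneg_left h2 hC₀.le, mul_nonneg (mul_nonneg hC₀.le hC₁.le) this]
    linarith

end IsMoranConstruction

end Cells

/-! ### Cut sets -/

section Cut

variable {X : Type*} [MetricSpace X] {m : ℕ}

open Classical in
/-- The words obtained from `w` by appending letters until the diameter of the cell is at most `δ`,
but at most `n` letters. -/
noncomputable def cut (E : List (Fin m) → Set X) (δ : ℝ) :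
    ℕ → List (Fin m) → Finset (List (Fin m))
  | 0, w => {w}
  | n + 1, w => if diam (E w) ≤ δ then {w} else Finset.univ.biUnion fun i => cut E δ n (w ++ [i])

/-- `L` is a partition of the cell `E w` into cells of diameter comparable to `δ`: the cells
`E v`, `v ∈ L`, are disjoint and cover the part of the limit set in `E w`, and `L` cuts every
branch of the tree of words below `w` exactly once. The latter is encoded by the values of
additive functions on words. -/
structure IsCutSet (E : List (Fin m) → Set X) (C₁ δ : ℝ) (w : List (Fin m))
    (L : Finset (List (Fin m))) : Prop where
  prefix_of_mem : ∀ u ∈ L, ∃ v, u = w ++ v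
  diam_le : ∀ u ∈ L, diam (E u) ≤ δ
  le_diam : ∀ u ∈ L, δ ≤ C₁ * diam (E u)
  disjoint : ∀ u ∈ L, ∀ v ∈ L, u ≠ v → Disjoint (E u) (E v)
  cover : ∀ x ∈ limitSet E, x ∈ E w → ∃ u ∈ L, x ∈ E u
  sum_eq : ∀ g : List (Fin m) → ℝ, (∀ u, ∑ i, g (u ++ [i]) = g u) → ∑ u ∈ L, g u = g w

variable {E : List (Fin m) → Set X} {C₁ δ : ℝ}

lemma exists_of_mem_cut {n : ℕ} {w u : List (Fin m)} (hu : u ∈ cut E δ n w) :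
    ∃ v, u = w ++ v ∧ (diam (E u) ≤ δ ∨ v.length = n) := by
  induction n generalizing w with
  | zero => exact ⟨[], by simpa [cut] using hu, by simp⟩
  | succ n ih =>
    rw [cut] at hu
    split_ifs at hu with h
    · rw [Finset.mem_singleton] at hu
      subst hu
      exact ⟨[], by simp, Or.inl h⟩
    · obtain ⟨i, -, hi⟩ := Finset.mem_biUnion.1 hu
      obtain ⟨v, rfl, hv⟩ := ih hi
      exact ⟨i :: v, by simp, by simpa using hv⟩

lemma le_diam_of_mem_cut (hC₁ : ∀ w i, diam (E w) ≤ C₁ * diam (E (w ++ [i])))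
    {n : ℕ} {w u : List (Fin m)} (hw : δ ≤ C₁ * diam (E w)) (hu : u ∈ cut E δ n w) :
    δ ≤ C₁ * diam (E u) := by
  induction n generalizing w with
  | zero =>
    rw [cut, Finset.mem_singleton] at hu
    rwa [hu]
  | succ n ih =>
    rw [cut] at hu
    split_ifs at hu with h
    · rw [Finset.mem_singleton] at hu
      rwa [hu]
    · obtain ⟨i, -, hi⟩ := Finset.mem_biUnion.1 hu
      exact ih ((le_of_not_ge h).trans (hC₁ w i)) hi

lemma subset_of_mem_cut (hE : IsMoranConstruction E) {n : ℕ} {w u : List (Fin m)}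
    (hu : u ∈ cut E δ n w) : E u ⊆ E w := by
  obtain ⟨v, rfl, -⟩ := exists_of_mem_cut hu
  exact hE.append_subset w v

lemma disjoint_of_mem_cut (hE : IsMoranConstruction E) {n : ℕ} {w u v : List (Fin m)}
    (hu : u ∈ cut E δ n w) (hv : v ∈ cut E δ n w) (huv : u ≠ v) : Disjoint (E u) (E v) := by
  induction n generalizing w with
  | zero =>
    rw [cut, Finset.mem_singleton] at hu hv
    exact absurd (hu.trans hv.symm) huv
  | succ n ih =>
    rw [cut] at hu hv
    split_ifs at hu hv with h
    · rw [Finset.mem_singleton] at hu hv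
      exact absurd (hu.trans hv.symm) huv
    · obtain ⟨i, -, hi⟩ := Finset.mem_biUnion.1 hu
      obtain ⟨j, -, hj⟩ := Finset.mem_biUnion.1 hv
      by_cases hij : i = j
      · subst hij
        exact ih hi hj
      · exact (hE.disjoint w i j hij).mono (subset_of_mem_cut hE hi) (subset_of_mem_cut hE hj)

lemma exists_mem_cut (hE : IsMoranConstruction E) {n : ℕ} {w : List (Fin m)} {x : X}
    (hx : x ∈ limitSet E) (hw : x ∈ E w) : ∃ u ∈ cut E δ n w, x ∈ E u := by
  induction n generalizing w with
  | zero => exact ⟨w, by simp [cut], hw⟩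
  | succ n ih =>
    rw [cut]
    split_ifs with h
    · exact ⟨w, by simp, hw⟩
    · obtain ⟨i, hi⟩ := hE.exists_child hx hw
      obtain ⟨u, hu, hxu⟩ := ih hi
      exact ⟨u, Finset.mem_biUnion.2 ⟨i, Finset.mem_univ _, hu⟩, hxu⟩

lemma sum_cut_eq (hE : IsMoranConstruction E) {g : List (Fin m) → ℝ}
    (hg : ∀ u, ∑ i, g (u ++ [i]) = g u) (n : ℕ) (w : List (Fin m)) :
    ∑ u ∈ cut E δ n w, g u = g w := by
  induction n generalizing w with
  | zero => simp [cut]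
  | succ n ih =>
    rw [cut]
    split_ifs with h
    · simp
    · rw [Finset.sum_biUnion]
      · simp_rw [ih, hg]
      · intro i _ j _ hij
        refine Finset.disjoint_left.2 fun u hi hj => ?_
        obtain ⟨x, hx⟩ := hE.nonempty u
        exact disjoint_left.1 (hE.disjoint w i j hij) (subset_of_mem_cut hE hi hx)
          (subset_of_mem_cut hE hj hx)

lemma isCutSet_cut (hE : IsMoranConstruction E)
    (hC₁ : ∀ w i, diam (E w) ≤ C₁ * diam (E (w ++ [i]))) {w : List (Fin m)}
    (hw : δ ≤ C₁ * diam (E w)) {n : ℕ} (hn : ∀ v : List (Fin m), v.length = n →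
      diam (E (w ++ v)) ≤ δ) : IsCutSet E C₁ δ w (cut E δ n w) where
  prefix_of_mem u hu := (exists_of_mem_cut hu).imp fun v hv => hv.1
  diam_le u hu := by
    obtain ⟨v, rfl, h | h⟩ := exists_of_mem_cut hu
    · exact h
    · exact hn v h
  le_diam u hu := le_diam_of_mem_cut hC₁ hw hu
  disjoint u hu v hv := disjoint_of_mem_cut hE hu hv
  cover x hx hxw := exists_mem_cut hE hx hxw
  sum_eq g hg := sum_cut_eq hE hg n w

end Cut

/-! ### Sizes and measures of small cells -/

section Control

/-- A Moran construction with contraction functions `r`, and a measure on its limit set with limit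
weights `p`. -/
structure IsMoranSystem {X : Type*} [MetricSpace X] [MeasurableSpace X] {m : ℕ}
    (E : List (Fin m) → Set X) (r : Fin m → X → ℝ) (μ : Measure X) (p : Fin m → X → ℝ) :
    Prop where
  moran : IsMoranConstruction E
  r_cont : ∀ i, ContinuousOn (r i) (limitSet E)
  r_mem : ∀ i, ∀ x ∈ limitSet E, r i x ∈ Ioo (0 : ℝ) 1
  contraction : HasContractionFunctions E r
  support_eq : μ.support = limitSet E
  p_cont : ∀ i, ContinuousOn (p i) (limitSet E)
  p_mem : ∀ i, ∀ x ∈ limitSet E, p i x ∈ Ioo (0 : ℝ) 1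
  p_sum : ∀ x ∈ limitSet E, ∑ i, p i x = 1
  weights : HasLimitWeights μ E p

lemma abs_sum_map_sub_le {ι : Type*} {a b : ι → ℝ} {ε : ℝ} (h : ∀ i, |a i - b i| ≤ ε)
    (w : List ι) : |(w.map a).sum - (w.map b).sum| ≤ ε * w.length := by
  induction w with
  | nil => simp
  | cons i w ih =>
    have h1 := h i
    simp only [List.map_cons, List.sum_cons, List.length_cons]
    push_cast
    rw [abs_le] at *
    constructor <;> linarith

lemma log_wordProd {X : Type*} {m : ℕ} {r : Fin m → X → ℝ} {x : X} (h : ∀ i, 0 < r i x)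
    (w : List (Fin m)) :
    Real.log (wordProd r w x) = (w.map fun i => Real.log (r i x)).sum := by
  induction w with
  | nil => simp [wordProd]
  | cons i w ih =>
    have hw : 0 < wordProd r w x := List.prod_pos (by simpa using fun i _ => h i)
    have : wordProd r (i :: w) x = r i x * wordProd r w x := by simp [wordProd]
    rw [this, Real.log_mul (h i).ne' hw.ne', ih]
    simp

variable {X : Type*} [MetricSpace X] {m : ℕ} {E : List (Fin m) → Set X}

/-- A property of initial words holding uniformly over all infinite words is a property of all long
finite words. -/
lemma IsMoranConstruction.eventually_forall_word (hE : IsMoranConstruction E)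
    {Q : List (Fin m) → X → Prop}
    (h : ∀ᶠ n in atTop, ∀ z ∈ codingPairs E, Q (initialWord z.1 n) z.2) :
    ∀ᶠ n in atTop, ∀ w : List (Fin m), n ≤ w.length → ∀ y ∈ E w, y ∈ limitSet E → Q w y := by
  filter_upwards [eventually_forall_ge_atTop.2 h] with n hn w hw y hyw hy
  obtain ⟨t, ht⟩ := hE.exists_coding hy
  have := hn _ hw (t, y) ht
  rwa [hE.initialWord_eq ht hyw] at this

lemma IsMoranConstruction.eventually_abs_sub_lt (hE : IsMoranConstruction E) {f : X → ℝ}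
    (hf : ContinuousOn f (limitSet E)) {x : X} {s : ℕ → Fin m} (hs : (s, x) ∈ codingPairs E)
    {ε : ℝ} (hε : 0 < ε) :
    ∀ᶠ n in atTop, ∀ y ∈ E (initialWord s n), y ∈ limitSet E → |f y - f x| < ε := by
  obtain ⟨d, hd, hfd⟩ := Metric.continuousOn_iff.1 hf x (mem_limitSet_of_coding hs) ε hε
  filter_upwards [(hE.diam_tendsto s).eventually (gt_mem_nhds hd)] with n hn y hyn hy
  refine hfd y hy ((dist_le_diam_of_mem (hE.compact _).isBounded hyn (hs n)).trans_lt hn)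

/-- The diameters and the measures of the cells below `w` agree, up to a factor that is
subexponential with small rate `ε`, with the products of constant ratios `R i` and constant
probabilities `P i`. -/
def IsControlled [MeasurableSpace X] (E : List (Fin m) → Set X) (μ : Measure X)
    (R P : Fin m → ℝ) (ε K : ℝ) (w : List (Fin m)) : Prop :=
  ∀ v : List (Fin m),
    |Real.log (diam (E (w ++ v))) - (v.map fun i => Real.log (R i)).sum| ≤ ε * v.length + K ∧
    |Real.log (μ.real (E (w ++ v))) - (v.map fun i => Real.log (P i)).sum| ≤ ε * v.length + K

variable [MeasurableSpace X] {r p : Fin m → X → ℝ} {μ : Measure X}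

namespace IsMoranSystem

lemma two_le (h : IsMoranSystem E r μ p) {x : X} (hx : x ∈ limitSet E) : 2 ≤ m := by
  by_contra hlt
  have hs := h.p_sum x hx
  obtain rfl | rfl : m = 0 ∨ m = 1 := by omega
  · simp at hs
  · rw [Fin.sum_univ_one] at hs
    exact absurd hs (h.p_mem 0 x hx).2.ne

lemma measure_cell_pos [OpensMeasurableSpace X] [SecondCountableTopology X]
    (h : IsMoranSystem E r μ p) (hm : 0 < m) (w : List (Fin m)) : 0 < μ (E w) := by
  obtain ⟨x, hxw, hx⟩ := h.moran.inter_limitSet_nonempty hm w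
  obtain ⟨d, hd, hsub⟩ := h.moran.exists_closedBall_inter_limitSet_subset w
  have h1 : 0 < μ (closedBall x d) := by
    rw [← h.support_eq] at hx
    exact (Measure.mem_support_iff_forall x).1 hx _ (closedBall_mem_nhds x hd)
  refine h1.trans_le (measure_mono_ae ?_)
  have h2 : limitSet E ∈ ae μ := h.support_eq ▸ Measure.support_mem_ae
  filter_upwards [h2] with y hy hyd using hsub x hxw ⟨hyd, hy⟩

lemma measureReal_cell_pos [OpensMeasurableSpace X] [SecondCountableTopology X]
    [IsFiniteMeasure μ] (h : IsMoranSystem E r μ p) (hm : 0 < m) (w : List (Fin m)) :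
    0 < μ.real (E w) :=
  ENNReal.toReal_pos (h.measure_cell_pos hm w).ne' (measure_ne_top _ _)

lemma eventually_abs_log_weight_sub_le (h : IsMoranSystem E r μ p) {x : X} {s : ℕ → Fin m}
    (hs : (s, x) ∈ codingPairs E) {ε : ℝ} (hε : 0 < ε) :
    ∀ᶠ n in atTop, ∀ (v : List (Fin m)) (i : Fin m),
      |Real.log (weight μ E (initialWord s n ++ v) i) - Real.log (p i x)| ≤ ε := by
  have hx := mem_limitSet_of_coding hs
  have hm : 0 < m := by have := h.two_le hx; omega
  have key : ∀ i : Fin m, ∀ᶠ n in atTop, ∀ v : List (Fin m),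
      |Real.log (weight μ E (initialWord s n ++ v) i) - Real.log (p i x)| ≤ ε := fun i => by
    obtain ⟨d, hd, hlog⟩ := Metric.continuousAt_iff.1
      (Real.continuousAt_log (h.p_mem i x hx).1.ne') ε hε
    have hw := h.moran.eventually_forall_word
      (Q := fun w y => dist (p i y) (weight μ E w i) < d / 2)
      (Metric.tendstoUniformlyOn_iff.1 (h.weights i) (d / 2) (by positivity))
    filter_upwards [hw, h.moran.eventually_abs_sub_lt (h.p_cont i) hs (half_pos hd)] with n h1 h2 v
    obtain ⟨y, hyv, hy⟩ := h.moran.inter_limitSet_nonempty hm (initialWord s n ++ v)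
    have h3 := h1 _ (by simp) y hyv hy
    have h4 := h2 y (h.moran.append_subset _ _ hyv) hy
    refine (hlog ?_).le
    rw [Real.dist_eq, abs_lt] at *
    constructor <;> linarith
  filter_upwards [eventually_all.2 key] with n hn v i using hn i v

lemma eventually_abs_log_diam_sub_le (h : IsMoranSystem E r μ p) {x : X} {s : ℕ → Fin m}
    (hs : (s, x) ∈ codingPairs E) {ε : ℝ} (hε : 0 < ε) :
    ∀ᶠ n in atTop, ∀ v : List (Fin m),
      |Real.log (diam (E (initialWord s n ++ v))) -
        ((initialWord s n ++ v).map fun i => Real.log (r i x)).sum| ≤ ε * (n + v.length) := by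
  have hx := mem_limitSet_of_coding hs
  have hm : 0 < m := by have := h.two_le hx; omega
  set A : ℝ := ∑ i, |Real.log (r i x)| + 1 with hA
  have hApos : 0 < A := by positivity
  have hAi : ∀ i, |Real.log (r i x)| + 1 ≤ A := fun i => by
    have := Finset.single_le_sum (f := fun i => |Real.log (r i x)|) (fun i _ => abs_nonneg _)
      (Finset.mem_univ i)
    linarith
  obtain ⟨ε₁, hε₁, hε₁'⟩ : ∃ ε₁, 0 < ε₁ ∧ ε₁ < 1 ∧ ε₁ * A ≤ ε / 2 := by
    refine ⟨min (1 / 2) (ε / (2 * A)), by positivity,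
      (min_le_left _ _).trans_lt (by norm_num), ?_⟩
    calc _ ≤ ε / (2 * A) * A := by gcongr; exact min_le_right _ _
      _ = ε / 2 := by field_simp
  have hw := h.moran.eventually_forall_word
    (Q := fun w y => dist 1 (Real.log (diam (E w)) / Real.log (wordProd r w y)) < ε₁)
    (Metric.tendstoUniformlyOn_iff.1 h.contraction ε₁ hε₁)
  have hc : ∀ i : Fin m, ∀ᶠ n in atTop, ∀ y ∈ E (initialWord s n), y ∈ limitSet E →
      |Real.log (r i y) - Real.log (r i x)| < min 1 (ε / 2) := fun i =>
    h.moran.eventually_abs_sub_lt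
      ((h.r_cont i).log fun y hy => (h.r_mem i y hy).1.ne') hs (by positivity)
  filter_upwards [hw, eventually_all.2 hc] with n h1 h2 v
  obtain ⟨y, hyv, hy⟩ := h.moran.inter_limitSet_nonempty hm (initialWord s n ++ v)
  have h3 := h1 _ (by simp) y hyv hy
  have h4 := fun i => h2 i y (h.moran.append_subset _ _ hyv) hy
  rw [log_wordProd fun i => (h.r_mem i y hy).1] at h3
  have hlen : ((initialWord s n ++ v).length : ℝ) = n + v.length := by simp
  rw [← hlen]
  generalize initialWord s n ++ v = w at *
  set a := Real.log (diam (E w))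
  set l := (w.map fun i => Real.log (r i y)).sum
  -- a vanishing denominator would make the quotient `0`, which is not close to `1`
  have hl : l ≠ 0 := by
    intro h0
    rw [h0, div_zero, Real.dist_eq, sub_zero, abs_one] at h3
    linarith [hε₁'.1]
  have h5 : |a - l| ≤ ε₁ * |l| := by
    have : a - l = (a / l - 1) * l := by field_simp
    rw [this, abs_mul, ← Real.dist_eq, dist_comm]
    gcongr
  have h6 : |l| ≤ A * w.length := by
    have := abs_sum_map_sub_le (a := fun i => Real.log (r i y)) (b := fun _ => 0) (ε := A)
      (fun i => by
        have h7 := (h4 i).trans_le (min_le_left _ _)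
        have h8 := hAi i
        have h9 := abs_add_le (Real.log (r i y) - Real.log (r i x)) (Real.log (r i x))
        simp only [sub_add_cancel, sub_zero] at h9 ⊢
        linarith) w
    simpa using this
  have h7 := abs_sum_map_sub_le (fun i => (h4 i).le.trans (min_le_right _ _)) w
  have h8 : ε₁ * |l| ≤ ε / 2 * w.length := by
    calc ε₁ * |l| ≤ ε₁ * (A * w.length) := by gcongr
      _ = ε₁ * A * w.length := by ring
      _ ≤ _ := by gcongr; exact hε₁'.2
  calc _ ≤ |a - l| + |l - (w.map fun i => Real.log (r i x)).sum| := abs_sub_le _ _ _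
    _ ≤ ε / 2 * w.length + ε / 2 * w.length := add_le_add (h5.trans h8) h7
    _ = ε * w.length := by ring

lemma eventually_isControlled [OpensMeasurableSpace X] [SecondCountableTopology X]
    [IsFiniteMeasure μ] (h : IsMoranSystem E r μ p) {x : X} {s : ℕ → Fin m}
    (hs : (s, x) ∈ codingPairs E) {ε : ℝ} (hε : 0 < ε) :
    ∀ᶠ n in atTop, ∃ K, 0 ≤ K ∧
      IsControlled E μ (fun i => r i x) (fun i => p i x) ε K (initialWord s n) := by
  have hx := mem_limitSet_of_coding hs
  have hm : 0 < m := by have := h.two_le hx; omega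
  filter_upwards [h.eventually_abs_log_weight_sub_le hs hε,
    h.eventually_abs_log_diam_sub_le hs hε] with n h1 h2
  set w := initialWord s n
  set a := (w.map fun i => Real.log (r i x)).sum
  set b := Real.log (μ.real (E w))
  have hm' : ∀ v : List (Fin m),
      |Real.log (μ.real (E (w ++ v))) - b - (v.map fun i => Real.log (p i x)).sum|
        ≤ ε * v.length := fun v => by
    induction v using List.reverseRecOn with
    | nil => simp [b]
    | append_singleton v i ih =>
      have h3 := h1 v i
      rw [weight, Real.log_div (h.measureReal_cell_pos hm _).ne' (h.measureReal_cell_pos hm _).ne',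
        List.append_assoc] at h3
      simp only [List.map_append, List.sum_append, List.map_cons, List.map_nil, List.sum_cons,
        List.sum_nil, List.length_append, List.length_cons, List.length_nil]
      push_cast
      rw [abs_le] at *
      constructor <;> linarith
  refine ⟨ε * n + |a| + |b|, by positivity, fun v => ⟨?_, ?_⟩⟩
  · have h3 := h2 v
    rw [List.map_append, List.sum_append] at h3
    have h4 := abs_le.1 (le_refl |a|)
    have h5 := abs_nonneg b
    rw [abs_le] at *
    constructor <;> linarith
  · have h3 := hm' v
    have h4 := abs_le.1 (le_refl |b|)
    have h5 := abs_nonneg a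
    have h6 : 0 ≤ ε * n := by positivity
    rw [abs_le] at *
    constructor <;> linarith

end IsMoranSystem

/-- A multiplicative function on words given by a probability vector is additive over children. -/
lemma sum_prod_map_append {c : Fin m → ℝ} (hc : ∑ i, c i = 1) (u : List (Fin m)) :
    ∑ i, ((u ++ [i]).map c).prod = (u.map c).prod := by
  simp [← Finset.mul_sum, hc]

lemma log_prod_map {c : Fin m → ℝ} (hc : ∀ i, 0 < c i) (v : List (Fin m)) :
    Real.log (v.map c).prod = (v.map fun i => Real.log (c i)).sum := by
  rw [Real.log_list_prod]
  · simp [Function.comp_def]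
  · simpa using fun i _ => (hc i).ne'

lemma sum_map_mul_sub_mul {ι : Type*} (a b : ι → ℝ) (s t : ℝ) (v : List ι) :
    (v.map fun i => s * a i - t * b i).sum = s * (v.map a).sum - t * (v.map b).sum := by
  induction v with
  | nil => simp
  | cons i v ih =>
    simp only [List.map_cons, List.sum_cons, ih]
    ring

/-- The number of letters needed to pass from a controlled cell to a subcell of size `δ` is at most
of the order of `|log δ|`. -/
lemma IsControlled.length_le {R P : Fin m → ℝ} {ε K ρ C₁ δ : ℝ} {w v : List (Fin m)}
    (h : IsControlled E μ R P ε K w) (hρ : 0 < ρ) (hR : ∀ i, Real.log (R i) ≤ -ρ)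
    (hε : ε ≤ ρ / 2) (hδ : 0 < δ) (hle : δ ≤ C₁ * diam (E (w ++ v))) :
    (v.length : ℝ) ≤ 2 / ρ * (K + |Real.log C₁| - Real.log δ) := by
  have hpos : 0 < C₁ * diam (E (w ++ v)) := hδ.trans_le hle
  have h1 := Real.log_le_log hδ hle
  rw [Real.log_mul (left_ne_zero_of_mul hpos.ne') (right_ne_zero_of_mul hpos.ne')] at h1
  have h2 := (abs_le.1 (h v).1).2
  have h3 : (v.map fun i => Real.log (R i)).sum ≤ -ρ * v.length := by
    have := List.sum_le_card_nsmul (v.map fun i => Real.log (R i)) (-ρ)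
      (by simpa using fun i _ => hR i)
    simp only [List.length_map, nsmul_eq_mul] at this
    linarith
  have h4 : ε * v.length ≤ ρ / 2 * v.length := by gcongr
  have h5 := le_abs_self (Real.log C₁)
  have h6 : ρ / 2 * v.length ≤ K + |Real.log C₁| - Real.log δ := by linarith
  calc (v.length : ℝ) = 2 / ρ * (ρ / 2 * v.length) := by field_simp
    _ ≤ _ := by gcongr

/-- The moment sums over the cut sets of a controlled cell. Since `c i = P i ^ q * R i ^ (-τ)` is a
probability vector, the corresponding multiplicative function sums to one over every cut set. -/
lemma IsControlled.exists_cutSet_moment (hE : IsMoranConstruction E) (hm : 0 < m) {C₁ : ℝ}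
    (hC₁ : 0 < C₁) (hC : ∀ w i, diam (E w) ≤ C₁ * diam (E (w ++ [i])))
    (hdiam : ∀ w, 0 < diam (E w)) (hμ : ∀ w, 0 < μ.real (E w))
    {R P : Fin m → ℝ} (hR : ∀ i, 0 < R i) (hP : ∀ i, 0 < P i) {ε K ρ q τ η : ℝ}
    {w : List (Fin m)} (h : IsControlled E μ R P ε K w) (hε₀ : 0 < ε) (hρ : 0 < ρ)
    (hRρ : ∀ i, Real.log (R i) ≤ -ρ) (hε : ε ≤ ρ / 2)
    (hη : (|q| + |τ|) * ε * (2 / ρ) ≤ η)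
    (hτ : ∑ i, P i ^ q * R i ^ (-τ) = 1) :
    ∃ A : ℝ, ∀ δ : ℝ, 0 < δ → δ < 1 → δ < diam (E w) → ∃ L, IsCutSet E C₁ δ w L ∧
      Real.exp (-A) * δ ^ (τ + η) ≤ ∑ u ∈ L, μ.real (E u) ^ q ∧
      ∑ u ∈ L, μ.real (E u) ^ q ≤ Real.exp A * δ ^ (τ - η) := by
  set B := |Real.log C₁| with hB
  refine ⟨(|q| + |τ|) * (ε * (2 / ρ * (K + B)) + K) + |τ| * B, fun δ hδ hδ1 hδw => ?_⟩
  set A := (|q| + |τ|) * (ε * (2 / ρ * (K + B)) + K) + |τ| * B with hA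
  have hδC : δ ≤ C₁ * diam (E w) := by
    refine hδw.le.trans ((hC w ⟨0, hm⟩).trans ?_)
    gcongr
    exact hE.diam_append_le _ _
  -- after `n` letters all diameters are at most `δ`, by `length_le` with `1` in place of `C₁`
  obtain ⟨n, hn⟩ := exists_nat_gt (2 / ρ * (K + |Real.log 1| - Real.log δ))
  have hcut := isCutSet_cut hE hC hδC (n := n) fun v hv => by
    by_contra! hlt
    have := h.length_le hρ hRρ hε hδ (C₁ := 1) (v := v) (by linarith)
    rw [hv] at this
    linarith
  refine ⟨cut E δ n w, hcut, ?_⟩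
  set L := cut E δ n w
  set c : Fin m → ℝ := fun i => P i ^ q * R i ^ (-τ) with hc
  have hcpos : ∀ i, 0 < c i := fun i =>
    mul_pos (Real.rpow_pos_of_pos (hP i) _) (Real.rpow_pos_of_pos (hR i) _)
  have hprod : ∀ u : List (Fin m), 0 < (u.map c).prod := fun u =>
    List.prod_pos (by simpa using fun i _ => hcpos i)
  -- normalised so that `g w = 1`
  set g : List (Fin m) → ℝ := fun u => (u.map c).prod / (w.map c).prod with hg
  have hgsum : ∑ u ∈ L, g u = 1 := by
    rw [hcut.sum_eq g fun u => by
      rw [← Finset.sum_div, sum_prod_map_append hτ]]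
    exact div_self (hprod w).ne'
  have key : ∀ u ∈ L, |q * Real.log (μ.real (E u)) - τ * Real.log δ - Real.log (g u)|
      ≤ A - η * Real.log δ := by
    intro u hu
    obtain ⟨v, rfl⟩ := hcut.prefix_of_mem u hu
    have hgv : g (w ++ v) = (v.map c).prod := by
      simp only [hg, List.map_append, List.prod_append]
      rw [mul_div_cancel_left₀ _ (hprod w).ne']
    have hlogc : Real.log (g (w ++ v)) = q * (v.map fun i => Real.log (P i)).sum
        - τ * (v.map fun i => Real.log (R i)).sum := by
      rw [hgv, log_prod_map hcpos, ← sum_map_mul_sub_mul]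
      congr 2
      funext i
      rw [Real.log_mul (Real.rpow_pos_of_pos (hP i) _).ne' (Real.rpow_pos_of_pos (hR i) _).ne',
        Real.log_rpow (hP i), Real.log_rpow (hR i)]
      ring
    rw [hlogc]
    obtain ⟨hd, ha⟩ := h v
    have hlen := h.length_le hρ hRρ hε hδ (hcut.le_diam _ hu)
    have hd1 := Real.log_le_log (hdiam _) (hcut.diam_le _ hu)
    have hd2 := Real.log_le_log hδ (hcut.le_diam _ hu)
    rw [Real.log_mul hC₁.ne' (hdiam _).ne'] at hd2
    set a := Real.log (μ.real (E (w ++ v)))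
    set d := Real.log (diam (E (w ++ v)))
    set ps := (v.map fun i => Real.log (P i)).sum
    set rs := (v.map fun i => Real.log (R i)).sum
    set e := ε * v.length + K with he
    have hdδ : |d - Real.log δ| ≤ B := by
      have := le_abs_self (Real.log C₁)
      rw [abs_le]
      constructor <;> linarith
    have he' : e ≤ ε * (2 / ρ * (K + B)) + K + ε * (2 / ρ) * (-Real.log δ) := by
      calc e ≤ ε * (2 / ρ * (K + B - Real.log δ)) + K := by rw [he]; gcongr
        _ = _ := by ring
    have hlogδ : 0 ≤ -Real.log δ := by linarith [Real.log_nonpos hδ.le hδ1.le]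
    calc |q * a - τ * Real.log δ - (q * ps - τ * rs)|
        = |q * (a - ps) + -τ * (d - rs) + τ * (d - Real.log δ)| := by congr 1; ring
      _ ≤ |q * (a - ps)| + |-τ * (d - rs)| + |τ * (d - Real.log δ)| := abs_add_three _ _ _
      _ = |q| * |a - ps| + |τ| * |d - rs| + |τ| * |d - Real.log δ| := by
        rw [abs_mul, abs_mul, abs_mul, abs_neg]
      _ ≤ |q| * e + |τ| * e + |τ| * B := by gcongr
      _ = (|q| + |τ|) * e + |τ| * B := by ring
      _ ≤ (|q| + |τ|) * (ε * (2 / ρ * (K + B)) + K + ε * (2 / ρ) * (-Real.log δ)) + |τ| * B := by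
        gcongr
      _ = A + (|q| + |τ|) * ε * (2 / ρ) * (-Real.log δ) := by rw [hA]; ring
      _ ≤ A + η * (-Real.log δ) := by gcongr
      _ = A - η * Real.log δ := by ring
  have hgpos : ∀ u, 0 < g u := fun u => div_pos (hprod u) (hprod w)
  constructor
  · calc Real.exp (-A) * δ ^ (τ + η) = ∑ u ∈ L, g u * (Real.exp (-A) * δ ^ (τ + η)) := by
          rw [← Finset.sum_mul, hgsum, one_mul]
      _ ≤ _ := Finset.sum_le_sum fun u hu => by
        have := (abs_le.1 (key u hu)).1
        rw [Real.rpow_def_of_pos (hμ u), Real.rpow_def_of_pos hδ, ← Real.exp_log (hgpos u),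
          ← Real.exp_add, ← Real.exp_add, Real.exp_le_exp]
        linarith
  · calc _ ≤ ∑ u ∈ L, g u * (Real.exp A * δ ^ (τ - η)) := Finset.sum_le_sum fun u hu => by
          have := (abs_le.1 (key u hu)).2
          rw [Real.rpow_def_of_pos (hμ u), Real.rpow_def_of_pos hδ, ← Real.exp_log (hgpos u),
            ← Real.exp_add, ← Real.exp_add, Real.exp_le_exp]
          linarith
      _ = _ := by rw [← Finset.sum_mul, hgsum, one_mul]

/-- At every point `x` of the limit set, the moment sums of order `q` over the cut sets of the small
cells around `x` behave like `δ ^ τ`, where `∑ i, p i x ^ q * r i x ^ (-τ) = 1`. -/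
lemma IsMoranSystem.eventually_exists_cutSet_moment [OpensMeasurableSpace X]
    [SecondCountableTopology X] [IsFiniteMeasure μ] (h : IsMoranSystem E r μ p) {C₁ : ℝ}
    (hC₁ : 0 < C₁) (hC : ∀ w i, diam (E w) ≤ C₁ * diam (E (w ++ [i])))
    {x : X} {s : ℕ → Fin m} (hs : (s, x) ∈ codingPairs E) {q τ η : ℝ} (hη : 0 < η)
    (hτ : ∑ i, p i x ^ q * r i x ^ (-τ) = 1) :
    ∀ᶠ n in atTop, ∃ A : ℝ, ∀ δ : ℝ, 0 < δ → δ < 1 → δ < diam (E (initialWord s n)) →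
      ∃ L, IsCutSet E C₁ δ (initialWord s n) L ∧
        Real.exp (-A) * δ ^ (τ + η) ≤ ∑ u ∈ L, μ.real (E u) ^ q ∧
        ∑ u ∈ L, μ.real (E u) ^ q ≤ Real.exp A * δ ^ (τ - η) := by
  have hx := mem_limitSet_of_coding hs
  have hm2 := h.two_le hx
  have hm : 0 < m := by omega
  have : Nonempty (Fin m) := ⟨⟨0, hm⟩⟩
  obtain ⟨i₀, hi₀⟩ := Finite.exists_max fun i => Real.log (r i x)
  set ρ := -Real.log (r i₀ x) with hρ
  have hρ0 : 0 < ρ := by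
    have := Real.log_neg (h.r_mem i₀ x hx).1 (h.r_mem i₀ x hx).2
    linarith
  set T := |q| + |τ| + 1 with hT
  have hT0 : 0 < T := by positivity
  set ε := min (ρ / 2) (η * ρ / (2 * T)) with hε
  have hε0 : 0 < ε := by positivity
  filter_upwards [h.eventually_isControlled hs hε0] with n ⟨K, _, hctrl⟩
  refine hctrl.exists_cutSet_moment h.moran hm hC₁ hC (h.moran.diam_pos hm2)
    (h.measureReal_cell_pos hm) (fun i => (h.r_mem i x hx).1) (fun i => (h.p_mem i x hx).1)
    hε0 hρ0 (fun i => by have := hi₀ i; linarith) (min_le_left _ _) ?_ hτ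
  calc (|q| + |τ|) * ε * (2 / ρ) ≤ T * (η * ρ / (2 * T)) * (2 / ρ) := by
        gcongr
        · linarith
        · exact min_le_right _ _
    _ = η := by field_simp

end Control

/-! ### The pressure equation -/

section Pressure

variable {m : ℕ} {P R : Fin m → ℝ}

lemma pressure_strictMono (hm : 0 < m) (hP : ∀ i, 0 < P i) (hR : ∀ i, R i ∈ Ioo (0 : ℝ) 1)
    (q : ℝ) : StrictMono fun t : ℝ => ∑ i, P i ^ q * R i ^ (-t) := by
  intro a b hab
  have : Nonempty (Fin m) := ⟨⟨0, hm⟩⟩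
  refine Finset.sum_lt_sum_of_nonempty Finset.univ_nonempty fun i _ => ?_
  refine mul_lt_mul_of_pos_left ?_ (Real.rpow_pos_of_pos (hP i) q)
  exact Real.rpow_lt_rpow_of_exponent_gt (hR i).1 (hR i).2 (by linarith)

lemma exists_pressure_eq_one (hm : 0 < m) (hP : ∀ i, 0 < P i) (hR : ∀ i, R i ∈ Ioo (0 : ℝ) 1)
    (q : ℝ) : ∃ τ : ℝ, ∀ t : ℝ, ∑ i, P i ^ q * R i ^ (-t) = 1 ↔ t = τ := by
  have hcont : Continuous fun t : ℝ => ∑ i, P i ^ q * R i ^ (-t) :=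
    continuous_finsetSum _ fun i _ =>
      continuous_const.mul (continuous_const.rpow continuous_neg fun _ => Or.inl (hR i).1.ne')
  have hbot : Tendsto (fun t : ℝ => ∑ i, P i ^ q * R i ^ (-t)) atBot (𝓝 0) := by
    have : Tendsto (fun t : ℝ => ∑ i, P i ^ q * R i ^ (-t)) atBot (𝓝 (∑ i, P i ^ q * 0)) :=
      tendsto_finsetSum _ fun i _ => ((tendsto_rpow_atTop_of_base_lt_one _
        (by linarith [(hR i).1]) (hR i).2).comp tendsto_neg_atBot_atTop).const_mul _
    simpa using this
  have htop : Tendsto (fun t : ℝ => ∑ i, P i ^ q * R i ^ (-t)) atTop atTop := by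
    refine tendsto_atTop_mono (f := fun t => P ⟨0, hm⟩ ^ q * R ⟨0, hm⟩ ^ (-t)) (fun t => ?_) ?_
    · exact Finset.single_le_sum (f := fun i => P i ^ q * R i ^ (-t)) (fun i _ =>
        mul_nonneg (Real.rpow_nonneg (hP i).le _) (Real.rpow_nonneg (hR i).1.le _))
        (Finset.mem_univ _)
    · exact ((tendsto_rpow_atBot_of_base_lt_one _ (hR _).1 (hR _).2).comp
        tendsto_neg_atTop_atBot).const_mul_atTop (Real.rpow_pos_of_pos (hP _) q)
  obtain ⟨τ, hτ⟩ := mem_range_of_exists_le_of_exists_ge hcont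
    (hbot.eventually (ge_mem_nhds zero_lt_one)).exists (htop.eventually_ge_atTop 1).exists
  exact ⟨τ, fun t => ⟨fun ht => (pressure_strictMono hm hP hR q).injective (ht.trans hτ.symm),
    fun ht => ht ▸ hτ⟩⟩

lemma hasDerivAt_pressure_line (hP : ∀ i, 0 < P i) (hR : ∀ i, R i ∈ Ioo (0 : ℝ) 1) (a : ℝ) :
    HasDerivAt (fun q : ℝ => ∑ i, P i ^ q * R i ^ (-((q - 1) * a)))
      (∑ i, P i * Real.log (P i) - a * ∑ i, P i * Real.log (R i)) 1 := by
  rw [Finset.mul_sum, ← Finset.sum_sub_distrib]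
  refine HasDerivAt.fun_sum fun i _ => ?_
  have h1 : HasDerivAt (fun q : ℝ => P i ^ q) (P i ^ (1 : ℝ) * Real.log (P i)) 1 := by
    simpa [mul_comm] using (hasDerivAt_id (1 : ℝ)).const_rpow (hP i)
  have h2 : HasDerivAt (fun q : ℝ => -((q - 1) * a)) (-a) 1 := by
    simpa using (((hasDerivAt_id (1 : ℝ)).sub_const 1).mul_const a).fun_neg
  have h3 := h2.const_rpow (hR i).1
  refine (h1.fun_mul h3).congr_deriv ?_
  simp only [sub_self, zero_mul, neg_zero, Real.rpow_one, Real.rpow_zero]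
  ring

/-- The solution `τ` of the pressure equation vanishes at `q = 1` and has slope `D` there: somewhere
to the right of `1` it lies above the line through `(1, 0)` with slope `D - ε`, and somewhere to the
left of `1` it lies above the line with slope `D + ε`. -/
lemma exists_pressure_line_lt (hm : 0 < m) (hP : ∀ i, 0 < P i)
    (hR : ∀ i, R i ∈ Ioo (0 : ℝ) 1) (hsum : ∑ i, P i = 1) {D ε : ℝ} (hε : 0 < ε)
    (hD : D = (∑ i, P i * Real.log (P i)) / ∑ i, P i * Real.log (R i)) :
    (∃ q : ℝ, 1 < q ∧ ∑ i, P i ^ q * R i ^ (-((q - 1) * (D - ε))) < 1) ∧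
    ∃ q : ℝ, q < 1 ∧ ∑ i, P i ^ q * R i ^ (-((q - 1) * (D + ε))) < 1 := by
  have : Nonempty (Fin m) := ⟨⟨0, hm⟩⟩
  have hneg : ∑ i, P i * Real.log (R i) < 0 :=
    Finset.sum_neg (fun i _ => mul_neg_of_pos_of_neg (hP i) (Real.log_neg (hR i).1 (hR i).2))
      Finset.univ_nonempty
  rw [eq_div_iff hneg.ne] at hD
  have hval : ∀ a : ℝ, ∑ i, P i ^ (1 : ℝ) * R i ^ (-(((1 : ℝ) - 1) * a)) = 1 := fun a => by
    simpa using hsum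
  constructor
  · have h1 := hasDerivAt_iff_tendsto_slope.1 (hasDerivAt_pressure_line hP hR (D - ε))
    have h2 : ∑ i, P i * Real.log (P i) - (D - ε) * ∑ i, P i * Real.log (R i) < 0 := by nlinarith
    have h3 := (h1.eventually (gt_mem_nhds h2)).filter_mono
      (nhdsWithin_mono 1 (fun q (hq : q ∈ Ioi (1 : ℝ)) => ne_of_gt hq))
    obtain ⟨q, hq, hq1⟩ := (h3.and self_mem_nhdsWithin).exists
    rw [slope_def_field, hval, div_neg_iff] at hq
    have hq1 : 1 < q := hq1
    exact ⟨q, hq1, by rcases hq with hq | hq <;> linarith [hq.1, hq.2]⟩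
  · have h1 := hasDerivAt_iff_tendsto_slope.1 (hasDerivAt_pressure_line hP hR (D + ε))
    have h2 : 0 < ∑ i, P i * Real.log (P i) - (D + ε) * ∑ i, P i * Real.log (R i) := by nlinarith
    have h3 := (h1.eventually (lt_mem_nhds h2)).filter_mono
      (nhdsWithin_mono 1 (fun q (hq : q ∈ Iio (1 : ℝ)) => ne_of_lt hq))
    obtain ⟨q, hq, hq1⟩ := (h3.and self_mem_nhdsWithin).exists
    rw [slope_def_field, hval, div_pos_iff] at hq
    have hq1 : q < 1 := hq1
    exact ⟨q, hq1, by rcases hq with hq | hq <;> linarith [hq.1, hq.2]⟩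

end Pressure

/-! ### Exponents in the extended reals -/

section Exponents

lemma le_ereal_div_iff_of_neg {l : ℝ} (hl : l < 0) (a : ℝ) (x : EReal) :
    (a : EReal) ≤ x / (l : EReal) ↔ x ≤ ((a * l : ℝ) : EReal) := by
  induction x with
  | bot => simp [EReal.bot_div_of_neg_ne_bot (EReal.coe_neg'.2 hl) (EReal.coe_ne_bot l)]
  | coe x => rw [← EReal.coe_div, EReal.coe_le_coe_iff, EReal.coe_le_coe_iff, le_div_iff_of_neg hl]
  | top =>
    rw [EReal.top_div_of_neg_ne_bot (EReal.coe_neg'.2 hl) (EReal.coe_ne_bot l)]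
    simp only [le_bot_iff, top_le_iff, EReal.coe_ne_bot, EReal.coe_ne_top]

lemma ereal_div_le_iff_of_neg {l : ℝ} (hl : l < 0) (a : ℝ) (x : EReal) :
    x / (l : EReal) ≤ (a : EReal) ↔ ((a * l : ℝ) : EReal) ≤ x := by
  induction x with
  | bot =>
    rw [EReal.bot_div_of_neg_ne_bot (EReal.coe_neg'.2 hl) (EReal.coe_ne_bot l)]
    simp only [le_bot_iff, top_le_iff, EReal.coe_ne_bot, EReal.coe_ne_top]
  | coe x => rw [← EReal.coe_div, EReal.coe_le_coe_iff, EReal.coe_le_coe_iff, div_le_iff_of_neg hl]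
  | top => simp [EReal.top_div_of_neg_ne_bot (EReal.coe_neg'.2 hl) (EReal.coe_ne_bot l)]

lemma log_ofReal_rpow {δ : ℝ} (hδ : 0 < δ) (a : ℝ) :
    ENNReal.log (ENNReal.ofReal (δ ^ a)) = ((a * Real.log δ : ℝ) : EReal) := by
  rw [ENNReal.log_ofReal_of_pos (Real.rpow_pos_of_pos hδ a), Real.log_rpow hδ]

/-- Lower bounds for the extended real exponent of `S` at scale `δ` are upper bounds for `S`, since
`log δ < 0`. The cases `S = 0` and `S = ∞`, with exponents `⊤` and `⊥`, are included. -/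
lemma le_log_div_log_iff {δ : ℝ} (hδ : 0 < δ) (hδ1 : δ < 1) (a : ℝ) (S : ℝ≥0∞) :
    (a : EReal) ≤ ENNReal.log S / (Real.log δ : EReal) ↔ S ≤ ENNReal.ofReal (δ ^ a) := by
  rw [le_ereal_div_iff_of_neg (Real.log_neg hδ hδ1), ← log_ofReal_rpow hδ,
    ENNReal.log_le_log_iff]

lemma log_div_log_le_iff {δ : ℝ} (hδ : 0 < δ) (hδ1 : δ < 1) (a : ℝ) (S : ℝ≥0∞) :
    ENNReal.log S / (Real.log δ : EReal) ≤ a ↔ ENNReal.ofReal (δ ^ a) ≤ S := by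
  rw [ereal_div_le_iff_of_neg (Real.log_neg hδ hδ1), ← log_ofReal_rpow hδ,
    ENNReal.log_le_log_iff]

lemma eventually_mul_rpow_le {b a : ℝ} (hab : a < b) (A : ℝ) :
    ∀ᶠ δ : ℝ in 𝓝[>] 0, Real.exp A * δ ^ b ≤ δ ^ a := by
  have h : Tendsto (fun δ : ℝ => δ ^ (b - a)) (𝓝[>] 0) (𝓝 0) := by
    have := (Real.continuousAt_rpow_const 0 (b - a) (Or.inr (by linarith))).tendsto
    rw [Real.zero_rpow (by linarith)] at this
    exact this.mono_left nhdsWithin_le_nhds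
  filter_upwards [h.eventually (ge_mem_nhds (Real.exp_pos (-A))), self_mem_nhdsWithin] with δ h1 hδ
  have hδ : 0 < δ := hδ
  calc Real.exp A * δ ^ b = Real.exp A * (δ ^ (b - a) * δ ^ a) := by
        rw [← Real.rpow_add hδ, sub_add_cancel]
    _ ≤ Real.exp A * (Real.exp (-A) * δ ^ a) := by gcongr
    _ = δ ^ a := by rw [← mul_assoc, ← Real.exp_add]; simp

lemma tendsto_ereal_of_forall {α : Type*} {l : Filter α} {f : α → EReal} {D : ℝ}
    (h : ∀ ε : ℝ, 0 < ε → ∀ᶠ x in l, ((D - ε : ℝ) : EReal) ≤ f x ∧ f x ≤ ((D + ε : ℝ) : EReal)) :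
    Tendsto f l (𝓝 (D : EReal)) := by
  refine tendsto_order.2 ⟨fun a ha => ?_, fun a ha => ?_⟩
  · obtain ⟨c, hac, hc⟩ := EReal.lt_iff_exists_real_btwn.1 ha
    filter_upwards [h (D - c) (by have := EReal.coe_lt_coe_iff.1 hc; linarith)] with x hx
    refine hac.trans_le (by simpa using hx.1)
  · obtain ⟨c, hac, hc⟩ := EReal.lt_iff_exists_real_btwn.1 ha
    filter_upwards [h (c - D) (by have := EReal.coe_lt_coe_iff.1 hac; linarith)] with x hx
    refine lt_of_le_of_lt (by simpa using hx.2) hc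

end Exponents

/-! ### Packings and cut sets -/

section Packing

lemma rpow_sum_le_card_rpow_mul {κ : Type*} {N : Finset κ} (hN : N.Nonempty) {M : ℕ}
    (hM : N.card ≤ M) {a : κ → ℝ} (ha : ∀ u, 0 ≤ a u) {q : ℝ} (hq : 0 ≤ q) :
    (∑ u ∈ N, a u) ^ q ≤ (M : ℝ) ^ q * ∑ u ∈ N, a u ^ q := by
  obtain ⟨v, hv, hmax⟩ := N.exists_max_image a hN
  have h1 : ∑ u ∈ N, a u ≤ M * a v := by
    calc ∑ u ∈ N, a u ≤ N.card • a v := Finset.sum_le_card_nsmul _ _ _ hmax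
      _ = N.card * a v := nsmul_eq_mul _ _
      _ ≤ M * a v := by gcongr; exact ha v
  calc (∑ u ∈ N, a u) ^ q ≤ (M * a v) ^ q :=
        Real.rpow_le_rpow (Finset.sum_nonneg fun u _ => ha u) h1 hq
    _ = (M : ℝ) ^ q * a v ^ q := Real.mul_rpow (by positivity) (ha v)
    _ ≤ _ := by
      gcongr
      exact Finset.single_le_sum (f := fun u => a u ^ q)
        (fun u _ => Real.rpow_nonneg (ha u) q) hv

lemma sum_rpow_sum_le {ι κ : Type*} [DecidableEq κ] {L : Finset κ} {F : Finset ι}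
    {N : ι → Finset κ} {M₁ M₂ : ℕ}
    (hN : ∀ i ∈ F, N i ⊆ L) (hne : ∀ i ∈ F, (N i).Nonempty) (hM₁ : ∀ i ∈ F, (N i).card ≤ M₁)
    (hM₂ : ∀ u ∈ L, (F.filter fun i => u ∈ N i).card ≤ M₂)
    {a : κ → ℝ} (ha : ∀ u, 0 ≤ a u) {q : ℝ} (hq : 0 ≤ q) :
    ∑ i ∈ F, (∑ u ∈ N i, a u) ^ q ≤ (M₁ : ℝ) ^ q * M₂ * ∑ u ∈ L, a u ^ q := by
  have haq : ∀ u, 0 ≤ a u ^ q := fun u => Real.rpow_nonneg (ha u) q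
  calc ∑ i ∈ F, (∑ u ∈ N i, a u) ^ q
      ≤ ∑ i ∈ F, (M₁ : ℝ) ^ q * ∑ u ∈ N i, a u ^ q := Finset.sum_le_sum fun i hi =>
        rpow_sum_le_card_rpow_mul (hne i hi) (hM₁ i hi) ha hq
    _ = (M₁ : ℝ) ^ q * ∑ i ∈ F, ∑ u ∈ L, if u ∈ N i then a u ^ q else 0 := by
      rw [Finset.mul_sum]
      refine Finset.sum_congr rfl fun i hi => ?_
      rw [← Finset.sum_filter, Finset.filter_mem_eq_inter, Finset.inter_eq_right.2 (hN i hi)]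
    _ = (M₁ : ℝ) ^ q * ∑ u ∈ L, (F.filter fun i => u ∈ N i).card * a u ^ q := by
      rw [Finset.sum_comm]
      congr 1
      refine Finset.sum_congr rfl fun u _ => ?_
      rw [← Finset.sum_filter, Finset.sum_const, nsmul_eq_mul]
    _ ≤ (M₁ : ℝ) ^ q * ∑ u ∈ L, (M₂ : ℝ) * a u ^ q := by
      gcongr with u hu
      · exact haq u
      · exact_mod_cast hM₂ u hu
    _ = _ := by rw [← Finset.mul_sum, mul_assoc]

/-- Greedy selection: a family in which every member has at most `M` neighbours contains a family
without neighbours that carries at least the `M`-th part of the total weight. -/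
lemma exists_independent_subset {κ : Type*} (rel : κ → κ → Prop) (hrefl : ∀ u, rel u u)
    (hsymm : ∀ u v, rel u v → rel v u) {M : ℕ} (a : κ → ℝ) (ha : ∀ u, 0 ≤ a u) (L : Finset κ)
    (hM : ∀ u ∈ L, ∀ N ⊆ L, (∀ v ∈ N, rel u v) → N.card ≤ M) :
    ∃ L' ⊆ L, (∀ u ∈ L', ∀ v ∈ L', u ≠ v → ¬ rel u v) ∧
      ∑ u ∈ L, a u ≤ M * ∑ u ∈ L', a u := by
  classical
  induction L using Finset.strongInduction with
  | H L ih =>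
    rcases L.eq_empty_or_nonempty with rfl | hne
    · exact ⟨∅, by simp⟩
    -- take a member `v` of largest weight: its at most `M` neighbours weigh at most `M * a v`
    obtain ⟨v, hv, hmax⟩ := L.exists_max_image a hne
    set K := L.filter fun u => ¬ rel v u with hK
    have hKL : K ⊂ L := (Finset.filter_ssubset).2 ⟨v, hv, by simpa using hrefl v⟩
    obtain ⟨L', hL', hind, hsum⟩ := ih K hKL fun u hu N hN h =>
      hM u (hKL.subset hu) N (hN.trans hKL.subset) h
    have hvL' : ∀ u ∈ L', ¬ rel v u := fun u hu => (Finset.mem_filter.1 (hL' hu)).2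
    have hvn : v ∉ L' := fun h => hvL' v h (hrefl v)
    refine ⟨insert v L', Finset.insert_subset hv (hL'.trans hKL.subset), ?_, ?_⟩
    · intro u hu u' hu' hne'
      rw [Finset.mem_insert] at hu hu'
      rcases hu with rfl | hu
      · rcases hu' with rfl | hu'
        · exact absurd rfl hne'
        · exact hvL' _ hu'
      · rcases hu' with rfl | hu'
        · exact fun h => hvL' _ hu (hsymm _ _ h)
        · exact hind _ hu _ hu' hne'
    · rw [Finset.sum_insert hvn,
        ← Finset.sum_filter_add_sum_filter_not L (fun u => rel v u), mul_add]
      refine add_le_add ?_ hsum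
      calc ∑ u ∈ L.filter fun u => rel v u, a u
          ≤ (L.filter fun u => rel v u).card • a v :=
            Finset.sum_le_card_nsmul _ _ _ fun u hu => hmax u (Finset.mem_filter.1 hu).1
        _ = (L.filter fun u => rel v u).card * a v := nsmul_eq_mul _ _
        _ ≤ M * a v := by
          gcongr
          · exact ha v
          · exact hM v hv _ (Finset.filter_subset _ _) fun u hu => (Finset.mem_filter.1 hu).2

variable {X : Type*} [MetricSpace X] {m : ℕ} {E : List (Fin m) → Set X}

open Classical in
/-- The words `u ∈ L` whose cells meet the ball of radius `2 * δ` around `y`. -/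
noncomputable def near (E : List (Fin m) → Set X) (L : Finset (List (Fin m))) (δ : ℝ) (y : X) :
    Finset (List (Fin m)) :=
  L.filter fun u => (E u ∩ closedBall y (2 * δ)).Nonempty

lemma mem_near {L : Finset (List (Fin m))} {δ : ℝ} {y : X} {u : List (Fin m)} :
    u ∈ near E L δ y ↔ u ∈ L ∧ (E u ∩ closedBall y (2 * δ)).Nonempty := by
  classical exact Finset.mem_filter

lemma near_subset {L : Finset (List (Fin m))} {δ : ℝ} {y : X} : near E L δ y ⊆ L :=
  fun _ hu => (mem_near.1 hu).1

/-- `M` bounds the number of elements of a cut set of scale `δ` whose cells meet a ball of radius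
`3 * δ`. -/
def IsOverlapBound (E : List (Fin m) → Set X) (C₁ : ℝ) (M : ℕ) : Prop :=
  ∀ (δ : ℝ) (w : List (Fin m)) (L : Finset (List (Fin m))), 0 < δ → IsCutSet E C₁ δ w L →
    ∀ (z : X), ∀ N ⊆ L, (∀ u ∈ N, (E u ∩ closedBall z (3 * δ)).Nonempty) → N.card ≤ M

lemma IsMoranConstruction.exists_isOverlapBound (hE : IsMoranConstruction E)
    (hX : IsDoublingSpace X) {C₁ : ℝ} (hC₁ : 0 < C₁) : ∃ M, IsOverlapBound E C₁ M := by
  obtain ⟨M, hM⟩ := hE.exists_card_meeting_le hX hC₁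
  exact ⟨M, fun δ w L hδ hL z N hN hmeet => hM δ hδ z N
    (fun u hu => ⟨hL.diam_le u (hN hu), hL.le_diam u (hN hu)⟩)
    (fun u hu v hv => hL.disjoint u (hN hu) v (hN hv)) hmeet⟩

lemma IsOverlapBound.card_near_le {C₁ δ : ℝ} {M : ℕ} (hM : IsOverlapBound E C₁ M)
    {w : List (Fin m)} {L : Finset (List (Fin m))} (hδ : 0 < δ) (hL : IsCutSet E C₁ δ w L) (y : X) :
    (near E L δ y).card ≤ M :=
  hM δ w L hδ hL y _ near_subset fun u hu => (mem_near.1 hu).2.mono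
    (inter_subset_inter_right _ (closedBall_subset_closedBall (by linarith)))

lemma IsCutSet.near_nonempty {C₁ δ : ℝ} {w : List (Fin m)} {L : Finset (List (Fin m))}
    (hL : IsCutSet E C₁ δ w L) (hδ : 0 < δ) {y : X} (hy : y ∈ limitSet E) (hyw : y ∈ E w) :
    (near E L δ y).Nonempty := by
  obtain ⟨u, hu, hyu⟩ := hL.cover y hy hyw
  exact ⟨u, mem_near.2 ⟨hu, y, hyu, mem_closedBall_self (by linarith)⟩⟩

variable [MeasurableSpace X] {μ : Measure X}

lemma IsCutSet.measureReal_closedBall_le [IsFiniteMeasure μ] (hae : limitSet E ∈ ae μ) {C₁ δ : ℝ}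
    {w : List (Fin m)} {L : Finset (List (Fin m))} (hL : IsCutSet E C₁ δ w L) {y z : X}
    (hsub : closedBall y δ ∩ limitSet E ⊆ E w) (hyz : dist y z ≤ δ) :
    μ.real (closedBall y δ) ≤ ∑ u ∈ near E L δ z, μ.real (E u) := by
  refine le_trans ?_ (measureReal_biUnion_finset_le _ _)
  refine ENNReal.toReal_mono (measure_ne_top _ _) (measure_mono_ae ?_)
  filter_upwards [hae] with x hx hxy
  obtain ⟨u, hu, hxu⟩ := hL.cover x hx (hsub ⟨hxy, hx⟩)
  refine mem_iUnion₂.2 ⟨u, mem_near.2 ⟨hu, x, hxu, ?_⟩, hxu⟩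
  have h1 := dist_triangle x y z
  have h2 := mem_closedBall.1 hxy
  rw [mem_closedBall]
  linarith

lemma measure_rpow_eq_ofReal {Y : Type*} [MeasurableSpace Y] {μ : Measure Y} [IsFiniteMeasure μ]
    (B : Set Y) {q : ℝ} (hq : 0 ≤ q) :
    μ B ^ q = ENNReal.ofReal (μ.real B ^ q) := by
  rw [← ENNReal.ofReal_rpow_of_nonneg measureReal_nonneg hq, ofReal_measureReal]

/-- The moment sum over packings is at most a constant times the moment sum over a cut set, since
every ball of a packing is covered by boundedly many cells, and every cell meets boundedly many
balls. -/
lemma exists_momentSum_le (hX : IsDoublingSpace X) (hE : IsMoranConstruction E) {C₁ : ℝ}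
    {M : ℕ} (hM : IsOverlapBound E C₁ M) [IsFiniteMeasure μ] (hae : limitSet E ∈ ae μ)
    (hμ : μ.support = limitSet E) {q : ℝ} (hq : 0 ≤ q) :
    ∃ A : ℝ, ∀ (δ : ℝ) (w : List (Fin m)) (L : Finset (List (Fin m))), 0 < δ →
      IsCutSet E C₁ δ w L → ∀ S : Set X,
      (∀ y ∈ S, y ∈ limitSet E → y ∈ E w ∧ closedBall y δ ∩ limitSet E ⊆ E w) →
      momentSum μ q S δ ≤ ENNReal.ofReal (Real.exp A * ∑ u ∈ L, μ.real (E u) ^ q) := by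
  classical
  obtain ⟨M₂, hM₂⟩ := hX.exists_card_le (a := 3) (b := 1) (by norm_num) one_pos X
  -- the constant `M ^ q * M₂` is at most its exponential
  refine ⟨(M : ℝ) ^ q * M₂, fun δ w L hδ hL S hS => ?_⟩
  have hexp := Real.add_one_le_exp ((M : ℝ) ^ q * M₂)
  refine iSup₂_le fun C hC => ?_
  rw [ENNReal.tsum_eq_iSup_sum]
  refine iSup_le fun F => ?_
  obtain ⟨hCS, -, hdisj⟩ := hC
  rw [hμ] at hCS
  simp_rw [measure_rpow_eq_ofReal (μ := μ) _ hq]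
  rw [← ENNReal.ofReal_sum_of_nonneg fun y _ => Real.rpow_nonneg measureReal_nonneg q]
  refine ENNReal.ofReal_le_ofReal ?_
  set G : Finset X := F.map (Function.Embedding.subtype _) with hG
  have hGC : ∀ y ∈ G, y ∈ C := fun y hy => by
    obtain ⟨z, -, rfl⟩ := Finset.mem_map.1 hy
    exact z.2
  have hsum : ∑ y ∈ F, μ.real (closedBall (y : X) δ) ^ q =
      ∑ y ∈ G, μ.real (closedBall y δ) ^ q := by
    simp [hG]
  rw [hsum]
  have hGS : ∀ y ∈ G, y ∈ limitSet E ∧ y ∈ E w ∧ closedBall y δ ∩ limitSet E ⊆ E w := fun y hy =>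
    ⟨(hCS (hGC y hy)).2, hS y (hCS (hGC y hy)).1 (hCS (hGC y hy)).2⟩
  calc ∑ y ∈ G, μ.real (closedBall y δ) ^ q
      ≤ ∑ y ∈ G, (∑ u ∈ near E L δ y, μ.real (E u)) ^ q := Finset.sum_le_sum fun y hy =>
        Real.rpow_le_rpow measureReal_nonneg
          (hL.measureReal_closedBall_le hae (hGS y hy).2.2 (by simpa using hδ.le)) hq
    _ ≤ (M : ℝ) ^ q * M₂ * ∑ u ∈ L, μ.real (E u) ^ q := by
      refine sum_rpow_sum_le (fun y _ => near_subset)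
        (fun y hy => hL.near_nonempty hδ (hGS y hy).1 (hGS y hy).2.1)
        (fun y _ => hM.card_near_le hδ hL y) (fun u hu => ?_) (fun u => measureReal_nonneg) hq
      obtain ⟨c, hc⟩ := hE.nonempty u
      refine hM₂ δ hδ c _ id (fun y hy => ?_) fun y hy z hz hne => ?_
      · obtain ⟨-, x, hxu, hxy⟩ := mem_near.1 (Finset.mem_filter.1 hy).2
        have h1 := dist_le_diam_of_mem (hE.compact u).isBounded hxu hc
        have h2 := hL.diam_le u hu
        have h3 := dist_triangle_left y c x
        rw [mem_closedBall] at hxy ⊢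
        simp only [id]
        linarith
      · have h1 := hdisj (hGC y (Finset.mem_filter.1 hy).1) (hGC z (Finset.mem_filter.1 hz).1) hne
        by_contra! hle
        simp only [id, one_mul] at hle
        exact disjoint_left.1 h1 (mem_closedBall'.2 hle) (mem_closedBall_self hδ.le)
    _ ≤ _ := by
      have : 0 ≤ ∑ u ∈ L, μ.real (E u) ^ q :=
        Finset.sum_nonneg fun u _ => Real.rpow_nonneg measureReal_nonneg q
      gcongr
      linarith

/-- The moment sum over a cut set is at most a constant times the moment sum over packings: choose
balls centred in the cells and thin them out by greedy selection. -/
lemma sum_le_momentSum (hE : IsMoranConstruction E) (hm : 0 < m) {C₁ : ℝ}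
    {M : ℕ} (hM : IsOverlapBound E C₁ M) [IsFiniteMeasure μ]
    (hμ : μ.support = limitSet E) {q : ℝ} (hq : 0 ≤ q) {δ : ℝ} {w : List (Fin m)}
    {L : Finset (List (Fin m))} (hδ : 0 < δ) (hL : IsCutSet E C₁ δ w L) {S : Set X}
    (hS : E w ⊆ S) :
    ENNReal.ofReal (Real.exp (-M) * ∑ u ∈ L, μ.real (E u) ^ q) ≤ momentSum μ q S δ := by
  classical
  choose y hyE hy using fun u => hE.inter_limitSet_nonempty hm u
  obtain ⟨L', hL', hind, hsum⟩ := exists_independent_subset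
    (fun u v => (closedBall (y u) δ ∩ closedBall (y v) δ).Nonempty)
    (fun u => ⟨y u, by simpa using hδ.le⟩) (fun u v h => by rwa [inter_comm]) (M := M)
    (fun u => μ.real (E u) ^ q) (fun u => Real.rpow_nonneg measureReal_nonneg q) L
    (fun u _ N hN hrel => hM δ w L hδ hL (y u) N hN fun v hv => by
      obtain ⟨x, hxu, hxv⟩ := hrel v hv
      refine ⟨y v, hyE v, ?_⟩
      have h1 := dist_triangle_left (y v) (y u) x
      rw [mem_closedBall] at *
      linarith)
  have hne : ∀ u ∈ L', ∀ v ∈ L', u ≠ v → Disjoint (closedBall (y u) δ) (closedBall (y v) δ) :=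
    fun u hu v hv huv =>
      disjoint_iff_inter_eq_empty.2 (not_nonempty_iff_eq_empty.1 (hind u hu v hv huv))
  have hinj : Set.InjOn y L' := fun u hu v hv huv => by
    by_contra h
    exact disjoint_left.1 (hne u hu v hv h) (mem_closedBall_self hδ.le)
      (huv ▸ mem_closedBall_self hδ.le)
  have hpack : IsPackingCenters (S ∩ μ.support) δ ((L'.image y : Finset X) : Set X) := by
    refine ⟨?_, Finset.countable_toSet _, ?_⟩
    · intro z hz
      obtain ⟨u, hu, rfl⟩ := Finset.mem_image.1 hz
      refine ⟨hS ?_, hμ ▸ hy u⟩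
      obtain ⟨v, rfl⟩ := hL.prefix_of_mem u (hL' hu)
      exact hE.append_subset _ _ (hyE _)
    · intro z hz z' hz' hzz
      obtain ⟨u, hu, rfl⟩ := Finset.mem_image.1 hz
      obtain ⟨v, hv, rfl⟩ := Finset.mem_image.1 hz'
      exact hne u hu v hv fun h => hzz (h ▸ rfl)
  have hexp : Real.exp (-(M : ℝ)) * M ≤ 1 := by
    rw [Real.exp_neg, inv_mul_le_one₀ (Real.exp_pos _)]
    linarith [Real.add_one_le_exp (M : ℝ)]
  have hnn : 0 ≤ ∑ u ∈ L', μ.real (E u) ^ q :=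
    Finset.sum_nonneg fun u _ => Real.rpow_nonneg measureReal_nonneg q
  calc ENNReal.ofReal (Real.exp (-M) * ∑ u ∈ L, μ.real (E u) ^ q)
      ≤ ENNReal.ofReal (∑ u ∈ L', μ.real (E u) ^ q) := by
        refine ENNReal.ofReal_le_ofReal ?_
        calc _ ≤ Real.exp (-M) * (M * ∑ u ∈ L', μ.real (E u) ^ q) := by gcongr
          _ = (Real.exp (-M) * M) * ∑ u ∈ L', μ.real (E u) ^ q := by ring
          _ ≤ 1 * ∑ u ∈ L', μ.real (E u) ^ q := by gcongr
          _ = _ := one_mul _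
    _ = ∑ u ∈ L', μ (E u) ^ q := by
      rw [ENNReal.ofReal_sum_of_nonneg fun u _ => Real.rpow_nonneg measureReal_nonneg q]
      exact Finset.sum_congr rfl fun u _ => (measure_rpow_eq_ofReal _ hq).symm
    _ ≤ ∑ u ∈ L', μ (closedBall (y u) δ) ^ q := by
      refine Finset.sum_le_sum fun u hu => ENNReal.rpow_le_rpow (measure_mono fun z hz => ?_) hq
      exact (dist_le_diam_of_mem (hE.compact u).isBounded hz (hyE u)).trans
        (hL.diam_le u (hL' hu))
    _ = ∑ z ∈ L'.image y, μ (closedBall z δ) ^ q :=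
      (Finset.sum_image (f := fun z => μ (closedBall z δ) ^ q) hinj).symm
    _ = ∑' z : ((L'.image y : Finset X) : Set X), μ (closedBall (z : X) δ) ^ q :=
      (Finset.tsum_subtype' _ fun z => μ (closedBall z δ) ^ q).symm
    _ ≤ momentSum μ q S δ := le_iSup₂_of_le _ hpack le_rfl

end Packing

/-! ### The local `L^q`-spectrum -/

section Spectrum

variable {X : Type*} [MetricSpace X] [MeasurableSpace X] {m : ℕ} {E : List (Fin m) → Set X}
  {r p : Fin m → X → ℝ} {μ : Measure X}

lemma IsMoranSystem.hasLocalLqSpectrum [OpensMeasurableSpace X] [SecondCountableTopology X]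
    [IsFiniteMeasure μ] (h : IsMoranSystem E r μ p) (hX : IsDoublingSpace X) {x : X}
    (hx : x ∈ limitSet E) {q τ : ℝ} (hq : 0 ≤ q) (hτ : ∑ i, p i x ^ q * r i x ^ (-τ) = 1) :
    HasLocalLqSpectrum μ q x (τ : EReal) := by
  have hE := h.moran
  obtain ⟨s, hs⟩ := hE.exists_coding hx
  obtain ⟨C₁, hC₁, hC⟩ := hE.diam_ratio
  obtain ⟨M, hM⟩ := hE.exists_isOverlapBound hX hC₁
  have hm2 := h.two_le hx
  have hae : limitSet E ∈ ae μ := h.support_eq ▸ Measure.support_mem_ae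
  obtain ⟨A', hA'⟩ := exists_momentSum_le hX hE hM hae h.support_eq hq
  refine tendsto_ereal_of_forall fun ε hε => ?_
  have hmoment := h.eventually_exists_cutSet_moment hC₁ hC hs (half_pos hε) hτ
  have hlow : ∀ᶠ ρ : ℝ in 𝓝[>] 0, ((τ - ε : ℝ) : EReal) ≤ lqSpectrum μ q (closedBall x ρ) := by
    obtain ⟨n, A, hA⟩ := hmoment.exists
    obtain ⟨d, hd, hsub⟩ := hE.exists_closedBall_inter_limitSet_subset (initialWord s n)
    filter_upwards [Ioc_mem_nhdsGT hd] with ρ hρ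
    refine le_liminf_of_le (by isBoundedDefault) ?_
    filter_upwards [Ioo_mem_nhdsGT (lt_min (lt_min one_pos hd)
      (hE.diam_pos hm2 (initialWord s n))),
      eventually_mul_rpow_le (show τ - ε < τ - ε / 2 by linarith) (A' + A)] with δ hδ hexp
    obtain ⟨hδ0, hδ1⟩ := hδ
    rw [lt_min_iff, lt_min_iff] at hδ1
    obtain ⟨L, hL, -, hup⟩ := hA δ hδ0 hδ1.1.1 hδ1.2
    rw [le_log_div_log_iff hδ0 hδ1.1.1]
    refine (hA' δ _ L hδ0 hL (closedBall x ρ) fun y hy hyE => ?_).trans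
      (ENNReal.ofReal_le_ofReal ?_)
    · have hyw := hsub x (hs n) ⟨closedBall_subset_closedBall hρ.2 hy, hyE⟩
      exact ⟨hyw, (inter_subset_inter_left _ (closedBall_subset_closedBall hδ1.1.2.le)).trans
        (hsub y hyw)⟩
    · calc _ ≤ Real.exp A' * (Real.exp A * δ ^ (τ - ε / 2)) := by gcongr
        _ = Real.exp (A' + A) * δ ^ (τ - ε / 2) := by rw [Real.exp_add, mul_assoc]
        _ ≤ _ := hexp
  have hupp : ∀ᶠ ρ : ℝ in 𝓝[>] 0, lqSpectrum μ q (closedBall x ρ) ≤ ((τ + ε : ℝ) : EReal) := by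
    filter_upwards [self_mem_nhdsWithin] with ρ hρ
    obtain ⟨n, ⟨A, hA⟩, hn⟩ :=
      (hmoment.and ((hE.diam_tendsto s).eventually (gt_mem_nhds hρ))).exists
    have hsub : E (initialWord s n) ⊆ closedBall x ρ := fun y hy =>
      (dist_le_diam_of_mem (hE.compact _).isBounded hy (hs n)).trans hn.le
    refine liminf_le_of_frequently_le' (Eventually.frequently ?_)
    filter_upwards [Ioo_mem_nhdsGT (lt_min one_pos (hE.diam_pos hm2 (initialWord s n))),
      eventually_mul_rpow_le (show τ + ε / 2 < τ + ε by linarith) (M + A)] with δ hδ hexp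
    obtain ⟨hδ0, hδ1⟩ := hδ
    rw [lt_min_iff] at hδ1
    obtain ⟨L, hL, hlo, -⟩ := hA δ hδ0 hδ1.1 hδ1.2
    rw [log_div_log_le_iff hδ0 hδ1.1]
    refine (ENNReal.ofReal_le_ofReal ?_).trans
      (sum_le_momentSum hE (by omega) hM h.support_eq hq hδ0 hL hsub)
    calc δ ^ (τ + ε) = Real.exp (-(M + A)) * (Real.exp (M + A) * δ ^ (τ + ε)) := by
          rw [← mul_assoc, ← Real.exp_add]; simp
      _ ≤ Real.exp (-(M + A)) * δ ^ (τ + ε / 2) := by gcongr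
      _ = Real.exp (-M) * (Real.exp (-A) * δ ^ (τ + ε / 2)) := by
        rw [neg_add, Real.exp_add, mul_assoc]
      _ ≤ _ := by gcongr
  filter_upwards [hlow, hupp] with ρ h1 h2 using ⟨h1, h2⟩

end Spectrum

/-! ### The local dimension -/

section LocalDimension

variable {X : Type*} [MetricSpace X] [MeasurableSpace X] {m : ℕ} {E : List (Fin m) → Set X}
  {μ : Measure X}

/-- Chebyshev's inequality for points with small balls: such a point lies in a cell of small
measure. -/
lemma IsCutSet.measureReal_small_ball_le [IsFiniteMeasure μ] (hE : IsMoranConstruction E)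
    (hμ : ∀ u, 0 < μ.real (E u)) {C₁ δ : ℝ} {w : List (Fin m)} {L : Finset (List (Fin m))}
    (hL : IsCutSet E C₁ δ w L) {q t : ℝ} (hq : q < 1)
    (ht : 0 < t) :
    μ.real {y | y ∈ limitSet E ∧ y ∈ E w ∧ μ.real (closedBall y δ) < t}
      ≤ t ^ (1 - q) * ∑ u ∈ L, μ.real (E u) ^ q := by
  classical
  have hsub : {y | y ∈ limitSet E ∧ y ∈ E w ∧ μ.real (closedBall y δ) < t} ⊆
      ⋃ u ∈ L.filter fun u => μ.real (E u) < t, E u := by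
    rintro y ⟨hy, hyw, hlt⟩
    obtain ⟨u, hu, hyu⟩ := hL.cover y hy hyw
    refine mem_iUnion₂.2 ⟨u, Finset.mem_filter.2 ⟨hu, lt_of_le_of_lt ?_ hlt⟩, hyu⟩
    exact measureReal_mono fun z hz =>
      (dist_le_diam_of_mem (hE.compact u).isBounded hz hyu).trans (hL.diam_le u hu)
  calc _ ≤ ∑ u ∈ L.filter fun u => μ.real (E u) < t, μ.real (E u) :=
        (measureReal_mono hsub (measure_ne_top _ _)).trans (measureReal_biUnion_finset_le _ _)
    _ ≤ ∑ u ∈ L.filter fun u => μ.real (E u) < t, t ^ (1 - q) * μ.real (E u) ^ q := by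
      refine Finset.sum_le_sum fun u hu => ?_
      calc μ.real (E u) = μ.real (E u) ^ (1 - q) * μ.real (E u) ^ q := by
            rw [← Real.rpow_add (hμ u), sub_add_cancel, Real.rpow_one]
        _ ≤ _ := mul_le_mul_of_nonneg_right (Real.rpow_le_rpow measureReal_nonneg
          (Finset.mem_filter.1 hu).2.le (by linarith)) (Real.rpow_nonneg measureReal_nonneg _)
    _ ≤ ∑ u ∈ L, t ^ (1 - q) * μ.real (E u) ^ q :=
      Finset.sum_le_sum_of_subset_of_nonneg (Finset.filter_subset _ _) fun u _ _ =>
        mul_nonneg (Real.rpow_nonneg ht.le _) (Real.rpow_nonneg measureReal_nonneg _)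
    _ = _ := by rw [Finset.mul_sum]

/-- Chebyshev's inequality for points with large balls: the cells near such a point have large total
measure. -/
lemma IsCutSet.measureReal_large_ball_le [IsFiniteMeasure μ] (hE : IsMoranConstruction E)
    (hae : limitSet E ∈ ae μ) {C₁ δ : ℝ} {M : ℕ} (hM : IsOverlapBound E C₁ M) (hδ : 0 < δ)
    {w : List (Fin m)} {L : Finset (List (Fin m))} (hL : IsCutSet E C₁ δ w L)
    (hsub : ∀ y ∈ E w, closedBall y δ ∩ limitSet E ⊆ E w) {q t : ℝ} (hq : 1 < q) (ht : 0 < t) :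
    μ.real {y | y ∈ limitSet E ∧ y ∈ E w ∧ t < μ.real (closedBall y δ)}
      ≤ t ^ (1 - q) * ((M : ℝ) ^ q * M * ∑ u ∈ L, μ.real (E u) ^ q) := by
  classical
  choose c hc using hE.nonempty
  set T : List (Fin m) → ℝ := fun u => ∑ v ∈ near E L δ (c u), μ.real (E v) with hT
  have hdist : ∀ u ∈ L, ∀ z ∈ E u, dist z (c u) ≤ δ := fun u hu z hz =>
    (dist_le_diam_of_mem (hE.compact u).isBounded hz (hc u)).trans (hL.diam_le u hu)
  have hself : ∀ u ∈ L, u ∈ near E L δ (c u) := fun u hu =>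
    mem_near.2 ⟨hu, c u, hc u, mem_closedBall_self (by linarith)⟩
  have hcov : {y | y ∈ limitSet E ∧ y ∈ E w ∧ t < μ.real (closedBall y δ)} ⊆
      ⋃ u ∈ L.filter fun u => t < T u, E u := by
    rintro y ⟨hy, hyw, hlt⟩
    obtain ⟨u, hu, hyu⟩ := hL.cover y hy hyw
    exact mem_iUnion₂.2 ⟨u, Finset.mem_filter.2 ⟨hu, hlt.trans_le
      (hL.measureReal_closedBall_le hae (hsub y hyw) (hdist u hu y hyu))⟩, hyu⟩
  have hTnn : ∀ u, 0 ≤ T u := fun u => Finset.sum_nonneg fun v _ => measureReal_nonneg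
  calc _ ≤ ∑ u ∈ L.filter fun u => t < T u, μ.real (E u) :=
        (measureReal_mono hcov (measure_ne_top _ _)).trans (measureReal_biUnion_finset_le _ _)
    _ ≤ ∑ u ∈ L.filter fun u => t < T u, t ^ (1 - q) * T u ^ q := by
      refine Finset.sum_le_sum fun u hu => ?_
      obtain ⟨huL, hut⟩ := Finset.mem_filter.1 hu
      calc μ.real (E u) ≤ T u := Finset.single_le_sum (f := fun v => μ.real (E v))
            (fun v _ => measureReal_nonneg) (hself u huL)
        _ = T u ^ (1 - q) * T u ^ q := by
          rw [← Real.rpow_add (ht.trans hut), sub_add_cancel, Real.rpow_one]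
        _ ≤ t ^ (1 - q) * T u ^ q := mul_le_mul_of_nonneg_right
          (Real.rpow_le_rpow_of_nonpos ht hut.le (by linarith)) (Real.rpow_nonneg (hTnn u) _)
    _ ≤ ∑ u ∈ L, t ^ (1 - q) * T u ^ q :=
      Finset.sum_le_sum_of_subset_of_nonneg (Finset.filter_subset _ _) fun u _ _ =>
        mul_nonneg (Real.rpow_nonneg ht.le _) (Real.rpow_nonneg (hTnn u) _)
    _ = t ^ (1 - q) * ∑ u ∈ L, T u ^ q := by rw [Finset.mul_sum]
    _ ≤ _ := by
      gcongr
      refine sum_rpow_sum_le (fun u _ => near_subset) (fun u hu => ⟨u, hself u hu⟩)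
        (fun u _ => hM.card_near_le hδ hL _) (fun v hv => ?_) (fun u => measureReal_nonneg)
        (by linarith)
      refine hM δ w L hδ hL (c v) _ (Finset.filter_subset _ _) fun u hu => ⟨c u, hc u, ?_⟩
      obtain ⟨-, x, hxv, hxu⟩ := mem_near.1 (Finset.mem_filter.1 hu).2
      have h1 := hdist v hv x hxv
      have h2 := dist_triangle_left (c u) (c v) x
      rw [mem_closedBall] at *
      linarith

/-- Borel–Cantelli along the scales `2 ^ (-k)`. -/
lemma ae_eventually_notMem_of_le_rpow {Y : Type*} [MeasurableSpace Y] {μ : Measure Y}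
    [IsFiniteMeasure μ] {s : ℝ → Set Y} {C κ : ℝ} (hκ : 0 < κ)
    (h : ∀ᶠ δ : ℝ in 𝓝[>] 0, μ.real (s δ) ≤ C * δ ^ κ) :
    ∀ᵐ y ∂μ, ∀ᶠ k : ℕ in atTop, y ∉ s ((1 / 2) ^ k) := by
  have hlim : Tendsto (fun k : ℕ => (1 / 2 : ℝ) ^ k) atTop (𝓝[>] 0) :=
    tendsto_pow_atTop_nhdsWithin_zero_of_lt_one (by norm_num) (by norm_num)
  obtain ⟨N, hN⟩ := eventually_atTop.1 (hlim.eventually h)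
  have hsummable : Summable fun k : ℕ => C * ((1 / 2 : ℝ) ^ (k + N)) ^ κ := by
    have h1 : ∀ k : ℕ, C * ((1 / 2 : ℝ) ^ (k + N)) ^ κ
        = C * ((1 / 2 : ℝ) ^ N) ^ κ * ((1 / 2 : ℝ) ^ κ) ^ k := fun k => by
      rw [pow_add, Real.mul_rpow (by positivity) (by positivity), ← Real.rpow_natCast,
        ← Real.rpow_natCast, ← Real.rpow_natCast, ← Real.rpow_mul (by norm_num),
        ← Real.rpow_mul (by norm_num), ← Real.rpow_mul (by norm_num), mul_comm κ]
      ring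
    simp_rw [h1]
    exact (summable_geometric_of_lt_one (by positivity)
      (Real.rpow_lt_one (by norm_num) (by norm_num) hκ)).mul_left _
  have hsum : ∑' k : ℕ, μ (s ((1 / 2) ^ (k + N))) ≠ ∞ := by
    refine ne_top_of_le_ne_top hsummable.tsum_ofReal_ne_top (ENNReal.tsum_le_tsum fun k => ?_)
    rw [← ofReal_measureReal]
    exact ENNReal.ofReal_le_ofReal (hN (k + N) (by omega))
  filter_upwards [ae_eventually_notMem hsum] with y hy
  obtain ⟨K, hK⟩ := eventually_atTop.1 hy
  refine eventually_atTop.2 ⟨K + N, fun k hk => ?_⟩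
  have := hK (k - N) (by omega)
  rwa [Nat.sub_add_cancel (by omega)] at this

/-- Power bounds along the scales `2 ^ (-k)` give power bounds at all scales. -/
lemma eventually_rpow_bounds_of_dyadic [IsFiniteMeasure μ] {y : X} {a b a' b' : ℝ} (ha : 0 ≤ a)
    (hb : 0 ≤ b) (ha' : a < a') (hb' : b' < b)
    (h : ∀ᶠ k : ℕ in atTop, ((1 / 2 : ℝ) ^ k) ^ a ≤ μ.real (closedBall y ((1 / 2) ^ k)) ∧
      μ.real (closedBall y ((1 / 2) ^ k)) ≤ ((1 / 2 : ℝ) ^ k) ^ b) :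
    ∀ᶠ δ : ℝ in 𝓝[>] 0, δ ^ a' ≤ μ.real (closedBall y δ) ∧ μ.real (closedBall y δ) ≤ δ ^ b' := by
  obtain ⟨N, hN⟩ := eventually_atTop.1 h
  have hpos : (0 : ℝ) < (1 / 2) ^ N := by positivity
  filter_upwards [Ioo_mem_nhdsGT hpos, eventually_mul_rpow_le ha' (Real.log 2 * a),
    eventually_mul_rpow_le hb' (Real.log 2 * b)] with δ hδ h1 h2
  obtain ⟨hδ0, hδN⟩ := hδ
  have hδ1 : δ ≤ 1 := hδN.le.trans (pow_le_one₀ (by norm_num) (by norm_num))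
  -- `(1 / 2) ^ (k + 1) < δ ≤ (1 / 2) ^ k`
  obtain ⟨k, hk1, hk2⟩ := exists_nat_pow_near_of_lt_one hδ0 hδ1
    (by norm_num : (0 : ℝ) < 1 / 2) (by norm_num)
  have hkN : N ≤ k := by
    have := (pow_lt_pow_iff_right_of_lt_one₀ (by norm_num : (0 : ℝ) < 1 / 2) (by norm_num)).1
      (hk1.trans hδN)
    omega
  rw [← Real.rpow_def_of_pos two_pos] at h1 h2
  constructor
  · calc δ ^ a' = (2 : ℝ)⁻¹ ^ a * ((2 : ℝ) ^ a * δ ^ a') := by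
          rw [← mul_assoc, ← Real.mul_rpow (by norm_num) (by norm_num)]; simp
      _ ≤ (2 : ℝ)⁻¹ ^ a * δ ^ a := by gcongr
      _ = (δ / 2) ^ a := by rw [← Real.mul_rpow (by norm_num) hδ0.le]; congr 1; ring
      _ ≤ ((1 / 2 : ℝ) ^ (k + 1)) ^ a := by
        gcongr
        rw [pow_succ]
        linarith
      _ ≤ μ.real (closedBall y ((1 / 2) ^ (k + 1))) := (hN (k + 1) (by omega)).1
      _ ≤ _ := measureReal_mono (closedBall_subset_closedBall hk1.le)
  · calc μ.real (closedBall y δ) ≤ μ.real (closedBall y ((1 / 2) ^ k)) :=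
          measureReal_mono (closedBall_subset_closedBall hk2)
      _ ≤ ((1 / 2 : ℝ) ^ k) ^ b := (hN k hkN).2
      _ ≤ (2 * δ) ^ b := by
        gcongr
        rw [pow_succ] at hk1
        linarith
      _ = (2 : ℝ) ^ b * δ ^ b := Real.mul_rpow (by norm_num) hδ0.le
      _ ≤ _ := h2

end LocalDimension

section AlmostEverywhere

variable {X : Type*} [MetricSpace X] [MeasurableSpace X] {m : ℕ} {E : List (Fin m) → Set X}
  {r p : Fin m → X → ℝ} {μ : Measure X}

/-- The value of the local dimension at `x`: entropy divided by Lyapunov exponent. -/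
noncomputable def localDimValue {X : Type*} {m : ℕ} (p r : Fin m → X → ℝ) (x : X) : ℝ :=
  (∑ i, p i x * Real.log (p i x)) / ∑ i, p i x * Real.log (r i x)

namespace IsMoranSystem

lemma sum_mul_log_r_neg (h : IsMoranSystem E r μ p) {x : X} (hx : x ∈ limitSet E) :
    ∑ i, p i x * Real.log (r i x) < 0 := by
  have : Nonempty (Fin m) := ⟨⟨0, by have := h.two_le hx; omega⟩⟩
  exact Finset.sum_neg (fun i _ => mul_neg_of_pos_of_neg (h.p_mem i x hx).1
    (Real.log_neg (h.r_mem i x hx).1 (h.r_mem i x hx).2)) Finset.univ_nonempty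

lemma localDimValue_pos (h : IsMoranSystem E r μ p) {x : X} (hx : x ∈ limitSet E) :
    0 < localDimValue p r x := by
  have : Nonempty (Fin m) := ⟨⟨0, by have := h.two_le hx; omega⟩⟩
  refine div_pos_of_neg_of_neg ?_ (h.sum_mul_log_r_neg hx)
  exact Finset.sum_neg (fun i _ => mul_neg_of_pos_of_neg (h.p_mem i x hx).1
    (Real.log_neg (h.p_mem i x hx).1 (h.p_mem i x hx).2)) Finset.univ_nonempty

lemma continuousOn_localDimValue (h : IsMoranSystem E r μ p) :
    ContinuousOn (localDimValue p r) (limitSet E) := by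
  refine ContinuousOn.div ?_ ?_ fun x hx => (h.sum_mul_log_r_neg hx).ne
  · exact continuousOn_finsetSum _ fun i _ => (h.p_cont i).mul
      ((h.p_cont i).log fun y hy => (h.p_mem i y hy).1.ne')
  · exact continuousOn_finsetSum _ fun i _ => (h.p_cont i).mul
      ((h.r_cont i).log fun y hy => (h.r_mem i y hy).1.ne')

lemma ae_mem_limitSet [SecondCountableTopology X] (h : IsMoranSystem E r μ p) :
    limitSet E ∈ ae μ :=
  h.support_eq ▸ Measure.support_mem_ae

variable [OpensMeasurableSpace X] [SecondCountableTopology X] [IsFiniteMeasure μ]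

lemma eventually_exists_cutSet_moment_le (h : IsMoranSystem E r μ p) {C₁ : ℝ}
    (hC₁ : 0 < C₁) (hC : ∀ w i, diam (E w) ≤ C₁ * diam (E (w ++ [i])))
    {x : X} {s : ℕ → Fin m} (hs : (s, x) ∈ codingPairs E) {q t η : ℝ} (hη : 0 < η)
    (ht : ∑ i, p i x ^ q * r i x ^ (-t) ≤ 1) :
    ∀ᶠ n in atTop, ∃ A : ℝ, ∀ δ : ℝ, 0 < δ → δ < 1 → δ < diam (E (initialWord s n)) →
      ∃ L, IsCutSet E C₁ δ (initialWord s n) L ∧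
        ∑ u ∈ L, μ.real (E u) ^ q ≤ Real.exp A * δ ^ (t - η) := by
  have hx := mem_limitSet_of_coding hs
  have hm : 0 < m := by have := h.two_le hx; omega
  obtain ⟨τ, hτ⟩ := exists_pressure_eq_one hm (fun i => (h.p_mem i x hx).1)
    (fun i => h.r_mem i x hx) q
  have htτ : t ≤ τ := (pressure_strictMono hm (fun i => (h.p_mem i x hx).1)
    (fun i => h.r_mem i x hx) q).le_iff_le.1 (ht.trans ((hτ τ).2 rfl).ge)
  filter_upwards [h.eventually_exists_cutSet_moment hC₁ hC hs hη ((hτ τ).2 rfl)] with n ⟨A, hA⟩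
  refine ⟨A, fun δ hδ hδ1 hδw => ?_⟩
  obtain ⟨L, hL, -, hle⟩ := hA δ hδ hδ1 hδw
  refine ⟨L, hL, hle.trans ?_⟩
  gcongr ?_ * ?_
  exact Real.rpow_le_rpow_of_exponent_ge hδ hδ1.le (by linarith)

/-- Near every point `x` of the limit set, almost all points have local dimensions close to the
value at `x`. The moments of order `q` close to `1` bound the measure of the exceptional sets at
scale `δ` by a positive power of `δ`, because `τ` has slope `localDimValue p r x` at `q = 1`. -/
lemma eventually_ae_rpow_bounds (h : IsMoranSystem E r μ p) (hX : IsDoublingSpace X)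
    {x : X} {s : ℕ → Fin m} (hs : (s, x) ∈ codingPairs E) {ε : ℝ} (hε : 0 < ε)
    (hεD : ε < localDimValue p r x) :
    ∀ᶠ n in atTop, ∀ᵐ y ∂μ, y ∈ E (initialWord s n) → ∀ᶠ δ : ℝ in 𝓝[>] 0,
      δ ^ (localDimValue p r x + ε) ≤ μ.real (closedBall y δ) ∧
      μ.real (closedBall y δ) ≤ δ ^ (localDimValue p r x - ε) := by
  have hx := mem_limitSet_of_coding hs
  have hE := h.moran
  have hm2 := h.two_le hx
  have hm : 0 < m := by omega
  obtain ⟨C₁, hC₁, hC⟩ := hE.diam_ratio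
  obtain ⟨M, hM⟩ := hE.exists_isOverlapBound hX hC₁
  set D := localDimValue p r x with hD
  obtain ⟨⟨q₁, hq₁, hlt₁⟩, q₀, hq₀, hlt₀⟩ := exists_pressure_line_lt hm
    (fun i => (h.p_mem i x hx).1) (fun i => h.r_mem i x hx) (h.p_sum x hx) (D := D)
    (ε := ε / 4) (by positivity) rfl
  -- slopes are off by `ε / 4` and thresholds by `ε / 2`; half of the remaining exponent
  -- `|q - 1| * (ε / 4)` is given up to the error in the moment bounds
  have hκ₁ : 0 < (q₁ - 1) * (ε / 8) := mul_pos (by linarith) (by positivity)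
  have hκ₀ : 0 < (1 - q₀) * (ε / 8) := mul_pos (by linarith) (by positivity)
  filter_upwards [h.eventually_exists_cutSet_moment_le hC₁ hC hs hκ₁ hlt₁.le,
    h.eventually_exists_cutSet_moment_le hC₁ hC hs hκ₀ hlt₀.le] with n ⟨A₁, hA₁⟩ ⟨A₀, hA₀⟩
  set w := initialWord s n
  obtain ⟨d, hd, hsub⟩ := hE.exists_closedBall_inter_limitSet_subset w
  have hsmall : ∀ᵐ y ∂μ, ∀ᶠ k : ℕ in atTop, y ∉ {y | y ∈ limitSet E ∧ y ∈ E w ∧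
      μ.real (closedBall y ((1 / 2) ^ k)) < ((1 / 2 : ℝ) ^ k) ^ (D + ε / 2)} := by
    refine ae_eventually_notMem_of_le_rpow (C := Real.exp A₀) (s := fun δ : ℝ =>
      {y | y ∈ limitSet E ∧ y ∈ E w ∧ μ.real (closedBall y δ) < δ ^ (D + ε / 2)}) hκ₀ ?_
    filter_upwards [Ioo_mem_nhdsGT (lt_min one_pos (hE.diam_pos hm2 w))] with δ hδ
    obtain ⟨hδ0, hδ1⟩ := hδ
    rw [lt_min_iff] at hδ1
    obtain ⟨L, hL, hle⟩ := hA₀ δ hδ0 hδ1.1 hδ1.2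
    refine (hL.measureReal_small_ball_le hE (h.measureReal_cell_pos hm) hq₀
      (Real.rpow_pos_of_pos hδ0 _)).trans ?_
    calc _ ≤ (δ ^ (D + ε / 2)) ^ (1 - q₀) * (Real.exp A₀ *
          δ ^ ((q₀ - 1) * (D + ε / 4) - (1 - q₀) * (ε / 8))) := by gcongr
      _ = Real.exp A₀ * (δ ^ ((D + ε / 2) * (1 - q₀)) *
          δ ^ ((q₀ - 1) * (D + ε / 4) - (1 - q₀) * (ε / 8))) := by
        rw [← Real.rpow_mul hδ0.le]; ring
      _ = Real.exp A₀ * δ ^ ((1 - q₀) * (ε / 8)) := by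
        rw [← Real.rpow_add hδ0]
        ring_nf
  have hlarge : ∀ᵐ y ∂μ, ∀ᶠ k : ℕ in atTop, y ∉ {y | y ∈ limitSet E ∧ y ∈ E w ∧
      ((1 / 2 : ℝ) ^ k) ^ (D - ε / 2) < μ.real (closedBall y ((1 / 2) ^ k))} := by
    refine ae_eventually_notMem_of_le_rpow (C := (M : ℝ) ^ q₁ * M * Real.exp A₁) (s := fun δ : ℝ =>
      {y | y ∈ limitSet E ∧ y ∈ E w ∧ δ ^ (D - ε / 2) < μ.real (closedBall y δ)}) hκ₁ ?_
    filter_upwards [Ioo_mem_nhdsGT (lt_min (lt_min one_pos hd) (hE.diam_pos hm2 w))] with δ hδ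
    obtain ⟨hδ0, hδ1⟩ := hδ
    rw [lt_min_iff, lt_min_iff] at hδ1
    obtain ⟨L, hL, hle⟩ := hA₁ δ hδ0 hδ1.1.1 hδ1.2
    refine (hL.measureReal_large_ball_le hE h.ae_mem_limitSet hM hδ0 (fun y hy =>
      (inter_subset_inter_left _ (closedBall_subset_closedBall hδ1.1.2.le)).trans (hsub y hy)) hq₁
      (Real.rpow_pos_of_pos hδ0 _)).trans ?_
    calc _ ≤ (δ ^ (D - ε / 2)) ^ (1 - q₁) * ((M : ℝ) ^ q₁ * M * (Real.exp A₁ *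
          δ ^ ((q₁ - 1) * (D - ε / 4) - (q₁ - 1) * (ε / 8)))) := by gcongr
      _ = (M : ℝ) ^ q₁ * M * Real.exp A₁ * (δ ^ ((D - ε / 2) * (1 - q₁)) *
          δ ^ ((q₁ - 1) * (D - ε / 4) - (q₁ - 1) * (ε / 8))) := by
        rw [← Real.rpow_mul hδ0.le]; ring
      _ = (M : ℝ) ^ q₁ * M * Real.exp A₁ * δ ^ ((q₁ - 1) * (ε / 8)) := by
        rw [← Real.rpow_add hδ0]
        ring_nf
  filter_upwards [hsmall, hlarge, h.ae_mem_limitSet] with y h1 h2 hy hyw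
  refine eventually_rpow_bounds_of_dyadic (a := D + ε / 2) (b := D - ε / 2) (by linarith)
    (by linarith) (by linarith) (by linarith) ?_
  filter_upwards [h1, h2] with k hk1 hk2
  exact ⟨not_lt.1 fun hlt => hk1 ⟨hy, hyw, hlt⟩, not_lt.1 fun hlt => hk2 ⟨hy, hyw, hlt⟩⟩

/-- At almost every point the local dimension exists and equals `localDimValue p r`. Only countably
many cells are involved, so the exceptional null sets may be collected. -/
lemma ae_tendsto_localDim (h : IsMoranSystem E r μ p) (hX : IsDoublingSpace X) :
    ∀ᵐ y ∂μ, Tendsto (fun δ : ℝ => ENNReal.log (μ (closedBall y δ)) / (Real.log δ : EReal))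
      (𝓝[>] 0) (𝓝 (localDimValue p r y : EReal)) := by
  set f : X → ℝ → EReal := fun y δ => ENNReal.log (μ (closedBall y δ)) / (Real.log δ : EReal)
  let Good : ℝ → List (Fin m) → Prop := fun ε w => ∀ᵐ y ∂μ, y ∈ E w → ∀ᶠ δ : ℝ in 𝓝[>] 0,
    ((localDimValue p r y - ε : ℝ) : EReal) ≤ f y δ ∧
      f y δ ≤ ((localDimValue p r y + ε : ℝ) : EReal)
  have hgood : ∀ ε : ℝ, 0 < ε → ∀ x ∈ limitSet E, ∃ w, x ∈ E w ∧ Good ε w := by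
    intro ε hε x hx
    obtain ⟨s, hs⟩ := h.moran.exists_coding hx
    have hDpos := h.localDimValue_pos hx
    set D := localDimValue p r x
    set e := min (ε / 2) (D / 2) with he
    have he0 : 0 < e := by positivity
    have heε : e ≤ ε / 2 := min_le_left _ _
    have heD : e < D := (min_le_right _ _).trans_lt (by linarith)
    obtain ⟨n, hn1, hn2⟩ := ((h.eventually_ae_rpow_bounds hX hs he0 heD).and
      (h.moran.eventually_abs_sub_lt h.continuousOn_localDimValue hs (half_pos hε))).exists
    refine ⟨initialWord s n, hs n, ?_⟩
    filter_upwards [hn1, h.ae_mem_limitSet] with y hy1 hy hyw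
    have hyD := abs_lt.1 (hn2 y hyw hy)
    filter_upwards [hy1 hyw, Ioo_mem_nhdsGT one_pos] with δ hδ hδ1
    constructor
    · refine le_trans (EReal.coe_le_coe_iff.2 (show _ ≤ D - e by linarith)) ?_
      rw [le_log_div_log_iff hδ1.1 hδ1.2, ← ofReal_measureReal (μ := μ) (s := closedBall y δ)]
      exact ENNReal.ofReal_le_ofReal hδ.2
    · refine le_trans ?_ (EReal.coe_le_coe_iff.2 (show D + e ≤ _ by linarith))
      rw [log_div_log_le_iff hδ1.1 hδ1.2, ← ofReal_measureReal (μ := μ) (s := closedBall y δ)]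
      exact ENNReal.ofReal_le_ofReal hδ.1
  have hall : ∀ᵐ y ∂μ, ∀ (k : ℕ) (w : List (Fin m)), Good (1 / (k + 1)) w → y ∈ E w →
      ∀ᶠ δ : ℝ in 𝓝[>] 0, ((localDimValue p r y - 1 / (k + 1) : ℝ) : EReal) ≤ f y δ ∧
        f y δ ≤ ((localDimValue p r y + 1 / (k + 1) : ℝ) : EReal) := by
    refine ae_all_iff.2 fun k => ae_all_iff.2 fun w => ?_
    by_cases hw : Good (1 / (k + 1)) w
    · exact hw.mono fun y hy _ => hy
    · exact ae_of_all _ fun y hw' => absurd hw' hw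
  filter_upwards [hall, h.ae_mem_limitSet] with y hy hyE
  refine tendsto_ereal_of_forall fun ε hε => ?_
  obtain ⟨k, hk⟩ := exists_nat_one_div_lt hε
  obtain ⟨w, hyw, hw⟩ := hgood (1 / (k + 1)) (by positivity) y hyE
  filter_upwards [hy k w hw hyw] with δ hδ
  exact ⟨le_trans (EReal.coe_le_coe_iff.2 (by linarith)) hδ.1,
    hδ.2.trans (EReal.coe_le_coe_iff.2 (by linarith))⟩

end IsMoranSystem

end AlmostEverywhere

/-! ### The local entropy dimension -/

section Entropy

variable {X : Type*} [MetricSpace X] [MeasurableSpace X] {m : ℕ} {E : List (Fin m) → Set X}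
  {r p : Fin m → X → ℝ} {μ : Measure X}

lemma measurable_measure_closedBall {X : Type*} [MetricSpace X] [MeasurableSpace X]
    [OpensMeasurableSpace X] [SecondCountableTopology X] (μ : Measure X) [SFinite μ] (δ : ℝ) :
    Measurable fun y => μ (closedBall y δ) := by
  have hclosed : IsClosed {z : X × X | dist z.2 z.1 ≤ δ} :=
    isClosed_le (continuous_snd.dist continuous_fst) continuous_const
  exact measurable_measure_prodMk_left hclosed.measurableSet

lemma measurable_log_measure_closedBall_div {X : Type*} [MetricSpace X] [MeasurableSpace X]
    [OpensMeasurableSpace X] [SecondCountableTopology X] (μ : Measure X) [SFinite μ] {δ : ℝ}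
    (hδ : 0 < δ) (hδ1 : δ < 1) :
    Measurable fun y => ENNReal.log (μ (closedBall y δ)) / (Real.log δ : EReal) := by
  have hneg : ((Real.log δ : ℝ) : EReal) ≤ 0 := EReal.coe_nonpos.2 (Real.log_neg hδ hδ1).le
  exact (EReal.antitone_div_right_of_nonpos hneg).measurable.comp
    (measurable_measure_closedBall μ δ).ennreal_log

/-- For `δ < 1` the negative part in the definition of the mean value vanishes, as `μ` is a
probability measure. -/
lemma meanEntropy_eq [IsProbabilityMeasure μ] (A : Set X) {δ : ℝ} (hδ : 0 < δ) (hδ1 : δ < 1) :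
    meanEntropy μ A δ = ((∫⁻ y in A,
      (ENNReal.log (μ (closedBall y δ)) / (Real.log δ : EReal)).toENNReal ∂μ : ℝ≥0∞) : EReal) /
        ((μ A : ℝ≥0∞) : EReal) := by
  have hneg : ∀ y, (-(ENNReal.log (μ (closedBall y δ)) / (Real.log δ : EReal))).toENNReal = 0 :=
    fun y => by
      refine EReal.toENNReal_of_nonpos (EReal.neg_le_zero.2 ?_)
      rw [← EReal.coe_zero, le_log_div_log_iff hδ hδ1]
      simpa using prob_le_one
  rw [meanEntropy, meanValue]
  simp [hneg]

/-- Bounds for the integral in `[0, ∞]` give bounds for the extended real mean value. -/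
lemma meanEntropy_mem [IsProbabilityMeasure μ] {A : Set X} (hA : μ A ≠ 0) {δ : ℝ} (hδ : 0 < δ)
    (hδ1 : δ < 1) {a b : ℝ} (ha : 0 ≤ a)
    (h1 : ENNReal.ofReal a * μ A ≤ ∫⁻ y in A,
      (ENNReal.log (μ (closedBall y δ)) / (Real.log δ : EReal)).toENNReal ∂μ)
    (h2 : ∫⁻ y in A, (ENNReal.log (μ (closedBall y δ)) / (Real.log δ : EReal)).toENNReal ∂μ ≤
      ENNReal.ofReal b * μ A) (hb : 0 ≤ b) :
    (a : EReal) ≤ meanEntropy μ A δ ∧ meanEntropy μ A δ ≤ (b : EReal) := by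
  have hpos : (0 : EReal) < ((μ A : ℝ≥0∞) : EReal) :=
    EReal.coe_ennreal_pos.2 (pos_iff_ne_zero.2 hA)
  have htop : ((μ A : ℝ≥0∞) : EReal) ≠ ⊤ := by
    simp
  rw [meanEntropy_eq A hδ hδ1, EReal.le_div_iff_mul_le hpos htop, EReal.div_le_iff_le_mul hpos htop]
  rw [← EReal.coe_ennreal_le_coe_ennreal_iff, EReal.coe_ennreal_mul, EReal.coe_ennreal_ofReal,
    max_eq_left ha] at h1
  rw [← EReal.coe_ennreal_le_coe_ennreal_iff, EReal.coe_ennreal_mul, EReal.coe_ennreal_ofReal,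
    max_eq_left hb] at h2
  exact ⟨h1, by rwa [mul_comm]⟩

namespace IsMoranSystem

variable [OpensMeasurableSpace X] [SecondCountableTopology X]

/-- The quotients `log μ(B(y,δ)) / log δ` are bounded near every point of the limit set. This is the
upper bound for the moment sums of order `q = -1`. -/
lemma exists_log_div_log_le [IsFiniteMeasure μ] (h : IsMoranSystem E r μ p) {x : X}
    (hx : x ∈ limitSet E) :
    ∃ d : ℝ, 0 < d ∧ ∃ K : ℝ, ∀ᶠ δ : ℝ in 𝓝[>] 0, ∀ y ∈ closedBall x d, y ∈ limitSet E →
      ENNReal.log (μ (closedBall y δ)) / (Real.log δ : EReal) ≤ (K : EReal) := by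
  have hE := h.moran
  obtain ⟨s, hs⟩ := hE.exists_coding hx
  obtain ⟨C₁, hC₁, hC⟩ := hE.diam_ratio
  have hm2 := h.two_le hx
  have hm : 0 < m := by omega
  obtain ⟨τ, hτ⟩ := exists_pressure_eq_one hm (fun i => (h.p_mem i x hx).1)
    (fun i => h.r_mem i x hx) (-1)
  obtain ⟨n, A, hA⟩ :=
    (h.eventually_exists_cutSet_moment hC₁ hC hs one_pos ((hτ τ).2 rfl)).exists
  obtain ⟨d, hd, hsub⟩ := hE.exists_closedBall_inter_limitSet_subset (initialWord s n)
  refine ⟨d, hd, -(τ - 1) + 1, ?_⟩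
  filter_upwards [Ioo_mem_nhdsGT (lt_min one_pos (hE.diam_pos hm2 (initialWord s n))),
    eventually_mul_rpow_le (show -(τ - 1) < -(τ - 1) + 1 by linarith) A] with δ hδ hexp y hyd hy
  obtain ⟨hδ0, hδ1⟩ := hδ
  rw [lt_min_iff] at hδ1
  obtain ⟨L, hL, -, hle⟩ := hA δ hδ0 hδ1.1 hδ1.2
  obtain ⟨u, hu, hyu⟩ := hL.cover y hy (hsub x (hs n) ⟨hyd, hy⟩)
  rw [log_div_log_le_iff hδ0 hδ1.1, ← ofReal_measureReal (μ := μ) (s := closedBall y δ)]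
  refine ENNReal.ofReal_le_ofReal ?_
  have hpos := h.measureReal_cell_pos hm u
  have h1 : (μ.real (E u))⁻¹ ≤ Real.exp A * δ ^ (τ - 1) := by
    rw [← Real.rpow_neg_one]
    exact (Finset.single_le_sum (f := fun u => μ.real (E u) ^ (-1 : ℝ))
      (fun u _ => Real.rpow_nonneg measureReal_nonneg _) hu).trans hle
  have h2 : μ.real (E u) ≤ μ.real (closedBall y δ) := measureReal_mono fun z hz =>
    (dist_le_diam_of_mem (hE.compact u).isBounded hz hyu).trans (hL.diam_le u hu)
  have hδτ := Real.rpow_pos_of_pos hδ0 (τ - 1)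
  have h3 : Real.exp A * δ ^ (-(τ - 1) + 1) * (Real.exp A * δ ^ (τ - 1)) ≤ Real.exp A := by
    calc _ ≤ δ ^ (-(τ - 1)) * (Real.exp A * δ ^ (τ - 1)) := by gcongr
      _ = Real.exp A := by
        rw [Real.rpow_neg hδ0.le]
        field_simp
  have h4 : δ ^ (-(τ - 1) + 1) * (Real.exp A * δ ^ (τ - 1)) ≤ 1 := by
    have := Real.exp_pos A
    rw [mul_assoc] at h3
    exact le_of_mul_le_mul_left (by linarith) this
  calc δ ^ (-(τ - 1) + 1) = δ ^ (-(τ - 1) + 1) * (μ.real (E u))⁻¹ * μ.real (E u) := by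
        field_simp
    _ ≤ δ ^ (-(τ - 1) + 1) * (Real.exp A * δ ^ (τ - 1)) * μ.real (E u) := by gcongr
    _ ≤ 1 * μ.real (E u) := by gcongr
    _ ≤ _ := by rwa [one_mul]

/-- Where `log μ(B(y,δ)) / log δ` is bounded, its integral converges to the integral of the local
dimension, by dominated convergence. -/
lemma tendsto_lintegral_localDim [IsProbabilityMeasure μ] (h : IsMoranSystem E r μ p)
    (hX : IsDoublingSpace X) {A : Set X} (hA : MeasurableSet A) {K : ℝ}
    (hK : ∀ᶠ δ : ℝ in 𝓝[>] 0, ∀ y ∈ A, y ∈ limitSet E →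
      ENNReal.log (μ (closedBall y δ)) / (Real.log δ : EReal) ≤ (K : EReal)) :
    Tendsto (fun δ : ℝ => ∫⁻ y in A,
        (ENNReal.log (μ (closedBall y δ)) / (Real.log δ : EReal)).toENNReal ∂μ) (𝓝[>] 0)
      (𝓝 (∫⁻ y in A, ENNReal.ofReal (localDimValue p r y) ∂μ)) := by
  refine tendsto_lintegral_filter_of_dominated_convergence (fun _ => ENNReal.ofReal K) ?_ ?_ ?_ ?_
  · filter_upwards [Ioo_mem_nhdsGT one_pos] with δ hδ
    exact (measurable_log_measure_closedBall_div μ hδ.1 hδ.2).ereal_toENNReal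
  · filter_upwards [hK] with δ hδ
    filter_upwards [ae_restrict_of_ae h.ae_mem_limitSet, ae_restrict_mem hA] with y hy hyA
    simpa using EReal.toENNReal_le_toENNReal (hδ y hyA hy)
  · rw [lintegral_const]
    exact ENNReal.mul_ne_top ENNReal.ofReal_ne_top (measure_ne_top _ _)
  · filter_upwards [ae_restrict_of_ae (h.ae_tendsto_localDim hX)] with y hy
    exact (EReal.continuous_toENNReal.tendsto _).comp hy

lemma localEntropyDim_eq [IsProbabilityMeasure μ] (h : IsMoranSystem E r μ p)
    (hX : IsDoublingSpace X) {x : X} (hx : x ∈ limitSet E) :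
    localUpperEntropyDim μ x = (localDimValue p r x : EReal) ∧
      localLowerEntropyDim μ x = (localDimValue p r x : EReal) := by
  have hDpos := h.localDimValue_pos hx
  set D := localDimValue p r x with hD
  have key : ∀ ε : ℝ, 0 < ε → ∀ᶠ ρ : ℝ in 𝓝[>] 0, ∀ᶠ δ : ℝ in 𝓝[>] 0,
      ((D - ε : ℝ) : EReal) ≤ meanEntropy μ (closedBall x ρ) δ ∧
        meanEntropy μ (closedBall x ρ) δ ≤ ((D + ε : ℝ) : EReal) := by
    intro ε hε
    set e := min (ε / 2) (D / 3) with he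
    have he0 : 0 < e := by positivity
    have heε : e ≤ ε / 2 := min_le_left _ _
    have heD : e ≤ D / 3 := min_le_right _ _
    obtain ⟨d, hd, K, hK⟩ := h.exists_log_div_log_le hx
    obtain ⟨d', hd', hcont⟩ := Metric.continuousOn_iff.1 h.continuousOn_localDimValue x hx e he0
    filter_upwards [Ioo_mem_nhdsGT (lt_min hd hd')] with ρ hρ
    obtain ⟨hρ0, hρ1⟩ := hρ
    rw [lt_min_iff] at hρ1
    set A := closedBall x ρ
    have hA : MeasurableSet A := measurableSet_closedBall
    have hA0 : μ A ≠ 0 := by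
      have hx' := hx
      rw [← h.support_eq] at hx'
      exact ((Measure.mem_support_iff_forall x).1 hx' _ (closedBall_mem_nhds x hρ0)).ne'
    have hlim := h.tendsto_lintegral_localDim hX hA (K := K) (by
      filter_upwards [hK] with δ hδ y hyA hy
      exact hδ y (closedBall_subset_closedBall hρ1.1.le hyA) hy)
    have hbd : ∀ᵐ y ∂μ.restrict A, D - e ≤ localDimValue p r y ∧ localDimValue p r y ≤ D + e := by
      filter_upwards [ae_restrict_of_ae h.ae_mem_limitSet, ae_restrict_mem hA] with y hy hyA
      have := hcont y hy (lt_of_le_of_lt hyA hρ1.2)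
      rw [Real.dist_eq, abs_lt] at this
      constructor <;> linarith
    set I := ∫⁻ y in A, ENNReal.ofReal (localDimValue p r y) ∂μ
    have hI1 : ENNReal.ofReal (D - e) * μ A ≤ I := by
      rw [← setLIntegral_const]
      exact lintegral_mono_ae (hbd.mono fun y hy => ENNReal.ofReal_le_ofReal hy.1)
    have hI2 : I ≤ ENNReal.ofReal (D + e) * μ A := by
      rw [← setLIntegral_const]
      exact lintegral_mono_ae (hbd.mono fun y hy => ENNReal.ofReal_le_ofReal hy.2)
    have hI1' : ENNReal.ofReal (D - 2 * e) * μ A < I := by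
      refine lt_of_lt_of_le ?_ hI1
      exact ENNReal.mul_lt_mul_left hA0 (measure_ne_top _ _)
        ((ENNReal.ofReal_lt_ofReal_iff (by linarith)).2 (by linarith))
    have hI2' : I < ENNReal.ofReal (D + 2 * e) * μ A := by
      refine lt_of_le_of_lt hI2 ?_
      exact ENNReal.mul_lt_mul_left hA0 (measure_ne_top _ _)
        ((ENNReal.ofReal_lt_ofReal_iff (by linarith)).2 (by linarith))
    filter_upwards [hlim.eventually (lt_mem_nhds hI1'), hlim.eventually (gt_mem_nhds hI2'),
      Ioo_mem_nhdsGT one_pos] with δ h1 h2 hδ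
    obtain ⟨h3, h4⟩ := meanEntropy_mem hA0 hδ.1 hδ.2 (by linarith) h1.le h2.le (by linarith)
    exact ⟨le_trans (EReal.coe_le_coe_iff.2 (by linarith)) h3,
      h4.trans (EReal.coe_le_coe_iff.2 (by linarith))⟩
  constructor
  · refine Tendsto.limsup_eq (tendsto_ereal_of_forall fun ε hε => ?_)
    filter_upwards [key ε hε] with ρ hρ
    exact ⟨le_limsup_of_frequently_le' (hρ.mono fun _ h => h.1).frequently,
      limsup_le_of_le (by isBoundedDefault) (hρ.mono fun _ h => h.2)⟩
  · refine Tendsto.liminf_eq (tendsto_ereal_of_forall fun ε hε => ?_)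
    filter_upwards [key ε hε] with ρ hρ
    exact ⟨le_liminf_of_le (by isBoundedDefault) (hρ.mono fun _ h => h.1),
      liminf_le_of_frequently_le' (hρ.mono fun _ h => h.2).frequently⟩

end IsMoranSystem

end Entropy

end MoranLq

theorem mainTheorem1 {X : Type*} [MetricSpace X] [CompleteSpace X] [MeasurableSpace X]
    [BorelSpace X] (hX : MoranLq.IsDoublingSpace X) {m : ℕ} (E : List (Fin m) → Set X)
    (hE : MoranLq.IsMoranConstruction E)
    (r : Fin m → X → ℝ)
    (hr_cont : ∀ i, ContinuousOn (r i) (MoranLq.limitSet E))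
    (hr_mem : ∀ i, ∀ x ∈ MoranLq.limitSet E, r i x ∈ Set.Ioo (0 : ℝ) 1)
    (hr : MoranLq.HasContractionFunctions E r)
    (μ : Measure X) [IsProbabilityMeasure μ] (hμ : μ.support = MoranLq.limitSet E)
    (p : Fin m → X → ℝ)
    (hp_cont : ∀ i, ContinuousOn (p i) (MoranLq.limitSet E))
    (hp_mem : ∀ i, ∀ x ∈ MoranLq.limitSet E, p i x ∈ Set.Ioo (0 : ℝ) 1)
    (hp_sum : ∀ x ∈ MoranLq.limitSet E, ∑ i, p i x = 1)
    (hp : MoranLq.HasLimitWeights μ E p) :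
    (∀ x ∈ MoranLq.limitSet E, ∀ q : ℝ, 0 ≤ q →
      ∃ τ : ℝ, MoranLq.HasLocalLqSpectrum μ q x (τ : EReal) ∧
        ∀ t : ℝ, ∑ i, p i x ^ q * r i x ^ (-t) = 1 ↔ t = τ) ∧
    (∀ᵐ x ∂μ, x ∈ MoranLq.limitSet E ∧
      let D : EReal :=
        (((∑ i, p i x * Real.log (p i x)) / (∑ i, p i x * Real.log (r i x)) : ℝ) : EReal)
      MoranLq.localUpperEntropyDim μ x = D ∧ MoranLq.localLowerEntropyDim μ x = D ∧
        MoranLq.upperLocalDim μ x = D ∧ MoranLq.lowerLocalDim μ x = D) := by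
  have hproper := hX.properSpace
  have h : MoranLq.IsMoranSystem E r μ p :=
    ⟨hE, hr_cont, hr_mem, hr, hμ, hp_cont, hp_mem, hp_sum, hp⟩
  refine ⟨fun x hx q hq => ?_, ?_⟩
  · have hm : 0 < m := by have := h.two_le hx; omega
    obtain ⟨τ, hτ⟩ := MoranLq.exists_pressure_eq_one hm (fun i => (hp_mem i x hx).1)
      (fun i => hr_mem i x hx) q
    exact ⟨τ, h.hasLocalLqSpectrum hX hx hq ((hτ τ).2 rfl), hτ⟩
  · filter_upwards [h.ae_mem_limitSet, h.ae_tendsto_localDim hX] with x hx hlim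
    obtain ⟨h1, h2⟩ := h.localEntropyDim_eq hX hx
    exact ⟨hx, h1, h2, hlim.limsup_eq, hlim.liminf_eq⟩
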